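/- Let $E$ be a Dedekind complete Riesz space with weak order unit $e$, let $T$ be a strictly positive conditional expectation operator on $E$ (a positive order continuous linear projection whose range $\mathcal R(T)$ is a Dedekind complete Riesz subspace and which maps weak order units to weak order units) with $Te=e$, and let $E$ be $T$-universally complete. That is, $E$ equals the natural domain $\mathrm{dom}(T)$ of $T$ in the universal completion $E^u$, which consists of the differences of elements $u\in E^u_+$ that are suprema of upward directed sets $D\subset E_+$ with $T(D)$ order bounded in $E^u$. Products are taken in $E^u$ with its $f$-algebra structure whose unit is $e$. Let $\mathcal L^2(T)=\{f\in E: f^2\in E\}$ and $\|f\|_{T,2}=\sqrt{T(f^2)}$ for $f\in\mathcal L^2(T)$. Let $\theta\in\mathcal R(T)$, and suppose that the band projection $P_{(e-|\theta|)^+}$ onto the band generated by $(e-|\theta|)^+$ is the identity. Let $(\varepsilon_n)_{n\ge1}\subset\mathcal L^2(T)$ satisfy $T\varepsilon_n=0$ for all $n\ge 1$, and let $g\in E_+$ be such that $\|\varepsilon_n\|_{T,2}\le g$ for all $n\ge1$. Let $f_0=0$ and let $(f_n)_{n\ge1}\subset\mathcal L^2(T)$ satisfy $f_n=\theta f_{n-1}+\varepsilon_n$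 for all $n\ge1$. Put $f_n=\varepsilon_n=0$ for all integers $n\le0$ (for $f_0$ this is already so). Then: (a) For all integers $i\le j$ there is a conditional expectation operator $T_i^j$ on $E$, compatible with $T$ (that is, $T\,T_i^j=T_i^j\,T=T$), whose range is the order closed Riesz subspace $\langle\{\varepsilon_r: i\le r\le j\}\cup\mathcal R(T)\rangle$ of $E$ generated by $\varepsilon_i,\dots,\varepsilon_j$ and $\mathcal R(T)$. (b) The element $e-|\theta|$ is invertible in $E^u$, and $\xi_m:=\dfrac{|\theta|^{m+1}}{e-|\theta|}$ lies in $E$ for every integer $m\ge0$. (c) For every family $(T_i^j)_{i\le j}$ of operators as in (a), $(f_n)_{n\in\mathbb Z}$ is near-epoch dependent in $\mathcal L^2(T)$ on $(T_i^j)$ with rate $(\xi_m)_{m\ge0}$. That is, $\mathcal R(T_{i+1}^j)\subset\mathcal R(T_i^j)\subset\mathcal R(T_i^{j+1})$ for all $i<j$, $f_n\in\mathcal L^2(T)$ for all $n$, $\xi_m\in\mathcal R(T)_+$ for all $m\ge0$, $\xi_m\to0$ in order, and there is a sequence $(d_n)_{n\in\mathbb Z}\subset\mathcal L^2(T)_+$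 such that $$\|f_n-T_{n-m}^{n+m}f_n\|_{T,2}\le d_n\,\xi_m\qquad\text{for all } n\in\mathbb Z,\ m\ge0 .$$ Moreover, for all $n\in\mathbb Z$ and $m\ge0$, $$\|f_n-T_{n-m}^{n+m}f_n\|_{T,2}\le g\,\xi_m .$$ -/

import Mathlib

namespace RieszNED

section OneSpace

variable {E : Type*} [ConditionallyCompleteLattice E] [AddCommGroup E] [IsOrderedAddMonoid E]
  [Module ℝ E]

/-- `e` is a weak order unit: a positive element to which only `0` is disjoint. -/
def IsWeakOrderUnit (e : E) : Prop :=
  0 ≤ e ∧ ∀ x : E, |x| ⊓ e = 0 → x = 0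

/-- The sequence `x` converges in order to `l`. -/
def OrderTendsto (x : ℕ → E) (l : E) : Prop :=
  ∃ y : ℕ → E, Antitone y ∧ IsGLB (Set.range y) 0 ∧ ∀ n, |x n - l| ≤ y n

/-- The band projection `P_f` onto the band generated by a positive element `f`:
`P_f x = sup_n (x ⊓ n f)` for `x ≥ 0`, and `P_f x = P_f x⁺ - P_f x⁻` in general. -/
noncomputable def bandProj (f x : E) : E :=
  sSup (Set.range fun n : ℕ => x⁺ ⊓ n • f) - sSup (Set.range fun n : ℕ => x⁻ ⊓ n • f)

/-- A linear subspace is a Riesz subspace if it is closed under the lattice operations. -/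
def IsRieszSubspace (F : Submodule ℝ E) : Prop :=
  ∀ x ∈ F, ∀ y ∈ F, x ⊔ y ∈ F ∧ x ⊓ y ∈ F

/-- `⟨A⟩`: the smallest order closed Riesz subspace of `E` that contains `A`. (A subspace is
closed under infima of downward directed subsets as soon as it is closed under suprema of upward
directed ones.) -/
def closedRieszSpan (A : Set E) : Submodule ℝ E :=
  sInf {F : Submodule ℝ E | IsRieszSubspace F ∧ DirSupClosed (F : Set E) ∧ A ⊆ F}

/-- Conditional expectation operators on the Dedekind complete Riesz space `E`: positive order
continuous linear projections whose range is a Dedekind complete Riesz subspace and which map weak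
order units to weak order units. -/
structure IsCondExp (T : E →ₗ[ℝ] E) : Prop where
  nonneg : ∀ x, 0 ≤ x → 0 ≤ T x
  orderContinuous : ∀ D : Set E, D.Nonempty → DirectedOn (· ≥ ·) D → IsGLB D 0 →
    IsGLB (T '' D) 0
  idem : ∀ x, T (T x) = T x
  range_riesz : IsRieszSubspace (LinearMap.range T)
  range_dedekind : ∀ s : Set (LinearMap.range T), s.Nonempty → BddAbove s → ∃ l, IsLUB s l
  map_unit : ∀ u, IsWeakOrderUnit u → IsWeakOrderUnit (T u)

/-- `T` is strictly positive. -/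
def IsStrictlyPositive (T : E →ₗ[ℝ] E) : Prop :=
  ∀ x, 0 < x → 0 < T x

/-- `S` is compatible with `T`: `TS = T = ST`. -/
def IsCompatible (T S : E →ₗ[ℝ] E) : Prop :=
  T ∘ₗ S = T ∧ S ∘ₗ T = T

/-- `S` is the conditional expectation operator compatible with `T` that is generated by
`ε_i, …, ε_j`: its range is `⟨{ε_r : i ≤ r ≤ j} ∪ R(T)⟩`. -/
structure IsGeneratedCondExp (T : E →ₗ[ℝ] E) (ε : ℤ → E) (i j : ℤ) (S : E →ₗ[ℝ] E) : Prop where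
  condExp : IsCondExp S
  compatible : IsCompatible T S
  range_eq : LinearMap.range S =
    closedRieszSpan ({x | ∃ r : ℤ, i ≤ r ∧ r ≤ j ∧ x = ε r} ∪ (LinearMap.range T : Set E))

/-- Extension of a sequence indexed by `n = 1, 2, …` to all integers, by `0` for `n ≤ 0`. -/
def extendZ (x : ℕ → E) (n : ℤ) : E :=
  if 0 < n then x n.toNat else 0

end OneSpace

section Completion

variable {E : Type*} [ConditionallyCompleteLattice E] [AddCommGroup E] [IsOrderedAddMonoid E]
  [Module ℝ E]
variable {U : Type*} [ConditionallyCompleteLattice U] [CommRing U] [IsOrderedRing U]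
  [Algebra ℝ U]

/-- `U` (a Dedekind complete Riesz space with an ordered algebra structure) together with the
embedding `ι` is the universal completion `E^u` of `E`, carrying the `f`-algebra multiplication
whose unit is `e`: `U` is laterally complete (hence universally complete), `ι` embeds `E` as an
order dense Riesz subspace, and multiplication by positive elements preserves disjointness. -/
structure IsUniversalCompletion (ι : E →ₗ[ℝ] U) (e : E) : Prop where
  laterallyComplete : ∀ s : Set U, s.Nonempty → (∀ x ∈ s, 0 ≤ x) →
    s.Pairwise (fun x y => x ⊓ y = 0) → ∃ l, IsLUB s l
  injective : Function.Injective ι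
  map_sup : ∀ x y, ι (x ⊔ y) = ι x ⊔ ι y
  orderDense : ∀ u : U, 0 < u → ∃ x : E, 0 < ι x ∧ ι x ≤ u
  mul_disjoint : ∀ a b c : U, a ⊓ b = 0 → 0 ≤ c → (c * a) ⊓ b = 0
  map_unit : ι e = 1

/-- The positive cone of the natural domain of `T` in `E^u`: all `u ≥ 0` that are the supremum of
an upward directed set `D` of positive elements of `E` such that `T D` is order bounded in
`E^u`. -/
def naturalDomainPos (ι : E →ₗ[ℝ] U) (T : E →ₗ[ℝ] E) : Set U :=
  {u | 0 ≤ u ∧ ∃ D : Set E, D.Nonempty ∧ DirectedOn (· ≤ ·) D ∧ (∀ x ∈ D, 0 ≤ x) ∧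
    IsLUB (ι '' D) u ∧ BddAbove ((fun x => ι (T x)) '' D)}

/-- The natural (that is, maximal) domain `dom(T)` of `T` in `E^u`. -/
def naturalDomain (ι : E →ₗ[ℝ] U) (T : E →ₗ[ℝ] E) : Set U :=
  {u | ∃ a ∈ naturalDomainPos ι T, ∃ b ∈ naturalDomainPos ι T, u = a - b}

/-- `E` is `T`-universally complete: `E = dom(T)` inside `E^u`. -/
def IsTUniversallyComplete (ι : E →ₗ[ℝ] U) (T : E →ₗ[ℝ] E) : Prop :=
  Set.range ι = naturalDomain ι T

/-- `f ∈ L²(T)`: the square of `f`, formed in `E^u`, lies in `E`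
(where `E = dom(T) = L¹(T)` is `T`-universally complete). -/
def MemL2 (ι : E →ₗ[ℝ] U) (f : E) : Prop :=
  ∃ s : E, ι s = ι f * ι f

/-- The `T`-conditional norm `‖f‖_{T,2} = √(T f²)` of `f ∈ L²(T)`, as an element of `E^u`:
the supremum is over the singleton consisting of the positive square root of `T f²`. -/
noncomputable def norm2 (ι : E →ₗ[ℝ] U) (T : E →ₗ[ℝ] E) (f : E) : U :=
  sSup {r : U | 0 ≤ r ∧ ∃ s : E, ι s = ι f * ι f ∧ r * r = ι (T s)}

/-- `f` is near-epoch dependent in `L²(T)` on the family `S i j = T_i^j` of conditional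
expectation operators, with the witnessing sequences `d` and `ξ`. -/
structure IsNearEpochDependentWith (ι : E →ₗ[ℝ] U) (T : E →ₗ[ℝ] E) (S : ℤ → ℤ → (E →ₗ[ℝ] E))
    (f d : ℤ → E) (ξ : ℕ → E) : Prop where
  condExp : ∀ i j, i ≤ j → IsCondExp (S i j) ∧ IsCompatible T (S i j)
  nested : ∀ i j, i < j → LinearMap.range (S (i + 1) j) ≤ LinearMap.range (S i j) ∧
    LinearMap.range (S i j) ≤ LinearMap.range (S i (j + 1))
  mem : ∀ n, MemL2 ι (f n)
  bound_mem : ∀ n, 0 ≤ d n ∧ MemL2 ι (d n)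
  rate_mem : ∀ m, 0 ≤ ξ m ∧ ξ m ∈ LinearMap.range T
  rate_tendsto : OrderTendsto ξ 0
  norm_le : ∀ (n : ℤ) (m : ℕ), norm2 ι T (f n - S (n - m) (n + m) (f n)) ≤ ι (d n) * ι (ξ m)

/-- `(f_n)_{n ≥ 0}` is a `T`-conditional autoregressive process of order 1 in `L²(T)` with
coefficient `θ` and noise `(ε_n)_{n ≥ 1}` (the value `ε 0` plays no role). -/
structure IsAR1 (ι : E →ₗ[ℝ] U) (T : E →ₗ[ℝ] E) (θ : E) (ε f : ℕ → E) : Prop where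
  coeff_mem : θ ∈ LinearMap.range T
  mem : ∀ n, 1 ≤ n → MemL2 ι (f n)
  noise_mem : ∀ n, 1 ≤ n → MemL2 ι (ε n)
  noise_mean_zero : ∀ n, 1 ≤ n → T (ε n) = 0
  init : f 0 = 0
  step : ∀ n, ι (f (n + 1)) = ι θ * ι (f n) + ι (ε (n + 1))

end Completion

end RieszNED

/-! Everything is computed in the universal completion `U`, where `E` is an order ideal `V`
containing `1`. Idempotents of `U` act as measurable sets, and `posIdem x` as the set where `x > 0`.
Since `U` is Archimedean, inequalities can be tested on a small nonzero idempotent where the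
elements concerned are bounded or nearly constant (`le_of_forall_idem`, `exists_idem_bound`,
`exists_idem_approx`).

The estimate: iterating the recursion gives f_n = ∑_{k ≤ m} θ^k ε_{n-k} + θ^{m+1} f_{n-m-1}. The sum
lies in the range of T_{n-m}^{n+m}, and a conditional expectation is the best mean square
approximation in its range, so the squared error is at most |θ|^{2(m+1)} T(f_{n-m-1}²). With w =
1/(1 - |θ|), convexity of the square gives T(f_k²) ≤ |θ| T(f_{k-1}²) + w T(ε_k²), and a bound b on
the noise norms becomes the bound b w on the norms of f (`autoregressive_bound`). Together the error
is at most b ξ_m (`autoregressive_error_le`).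

The rate: w is the sum of the geometric series of |θ|, whose partial sums are fixed by T, so w lies
in `E` by T-universal completeness; ξ_m is a tail of the same series and decreases to 0.

The operators T_i^j come from an Andô–Douglas theorem (`exists_isCondExp_range_eq`): a Radon–Nikodym
argument finds the conditional version of a positive element as a maximal sub-density. -/

namespace RieszNED

set_option linter.unusedSectionVars false

/-- A lattice ordered ring is an `f`-ring if multiplication by positive elements preserves
disjointness. -/
class IsFRing (U : Type*) [Lattice U] [CommRing U] : Prop where
  mul_disjoint : ∀ a b c : U, a ⊓ b = 0 → 0 ≤ c → (c * a) ⊓ b = 0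

/-! ### Archimedean property and disjointness in lattice groups. -/

section LatticeGroup

variable {G : Type*} [ConditionallyCompleteLattice G] [AddCommGroup G] [IsOrderedAddMonoid G]

/-- Archimedean property from Dedekind completeness: the supremum `s` of the multiples satisfies `s
+ x ≤ s`. -/
theorem nonpos_of_nsmul_le {x y : G} (h : ∀ n : ℕ, n • x ≤ y) : x ≤ 0 := by
  have hb : BddAbove (Set.range fun n : ℕ => n • x) := ⟨y, by rintro _ ⟨n, rfl⟩; exact h n⟩
  set s := sSup (Set.range fun n : ℕ => n • x) with hs
  have h1 : s ≤ s - x := by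
    refine csSup_le (Set.range_nonempty _) ?_
    rintro _ ⟨n, rfl⟩
    have : (n + 1) • x ≤ s := le_csSup hb ⟨n + 1, rfl⟩
    rw [succ_nsmul] at this
    exact le_sub_iff_add_le.2 this
  simpa using h1

/-- By `y ⊓ b = y + b - y ⊔ b`, the bound `d ⊓ b ≤ c` reads `d + b ≤ c + d ⊔ b ≤ c + x ⊔ b`, where
the supremum over `d` can be taken. -/
theorem isLUB_inf_const {D : Set G} {x : G} (h : IsLUB D x) (b : G) :
    IsLUB ((fun d => d ⊓ b) '' D) (x ⊓ b) := by
  constructor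
  · rintro _ ⟨d, hd, rfl⟩
    exact inf_le_inf_right _ (h.1 hd)
  · intro c hc
    have key : ∀ y : G, y ⊓ b = y + b - y ⊔ b := fun y => by rw [← inf_add_sup y b]; abel
    rw [key, sub_le_iff_le_add, ← le_sub_iff_add_le]
    refine h.2 fun d hd => ?_
    have := hc ⟨d, hd, rfl⟩
    simp only [key, sub_le_iff_le_add] at this
    rw [le_sub_iff_add_le]
    exact this.trans (by gcongr; exact h.1 hd)

theorem inf_eq_zero_add {a b c : G} (hc : 0 ≤ c) (ha : 0 ≤ a) (hb : 0 ≤ b) (h : a ⊓ c = 0)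
    (h' : b ⊓ c = 0) : (a + b) ⊓ c = 0 := by
  refine le_antisymm ?_ (le_inf (add_nonneg ha hb) hc)
  have h1 : (a + b) ⊓ c ≤ b := by
    have : (a + b) ⊓ c - b ≤ a ⊓ c := by
      refine le_inf ?_ ?_
      · rw [sub_le_iff_le_add]; exact inf_le_left
      · exact (sub_le_self _ hb).trans inf_le_right
    rw [h] at this
    exact sub_nonpos.1 this
  exact h' ▸ le_inf h1 inf_le_right

theorem nsmul_inf_eq_zero {a c : G} (ha : 0 ≤ a) (hc : 0 ≤ c) (h : a ⊓ c = 0) (n : ℕ) :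
    (n • a) ⊓ c = 0 := by
  induction n with
  | zero => simpa using hc
  | succ n ih =>
    rw [succ_nsmul]
    exact inf_eq_zero_add hc (nsmul_nonneg ha n) ha ih h

end LatticeGroup

/-! ### Squares, idempotents and localization in f-rings. -/

section FRing

variable {U : Type*} [ConditionallyCompleteLattice U] [CommRing U] [IsOrderedRing U] [IsFRing U]

theorem mul_eq_zero_of_inf_eq_zero {a b : U} (h : a ⊓ b = 0) : a * b = 0 := by
  have ha : 0 ≤ a := h ▸ inf_le_left
  have hb : 0 ≤ b := h ▸ inf_le_right
  have h1 := IsFRing.mul_disjoint a b b h hb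
  have h2 := IsFRing.mul_disjoint b (b * a) a (by rw [inf_comm]; exact h1) ha
  simpa [mul_comm] using h2

theorem posPart_mul_negPart (x : U) : x⁺ * x⁻ = 0 :=
  mul_eq_zero_of_inf_eq_zero (posPart_inf_negPart_eq_zero x)

theorem mul_self_nonneg_of_fRing (x : U) : 0 ≤ x * x := by
  have h : x * x = x⁺ * x⁺ + x⁻ * x⁻ := by
    have := posPart_mul_negPart x
    nth_rw 1 2 [← posPart_sub_negPart x]
    linear_combination -2 * this
  rw [h]
  exact add_nonneg (mul_nonneg (posPart_nonneg x) (posPart_nonneg x))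
    (mul_nonneg (negPart_nonneg x) (negPart_nonneg x))

theorem abs_mul_abs_of_fRing (x : U) : |x| * |x| = x * x := by
  have := posPart_mul_negPart x
  rw [← posPart_add_negPart x]
  nth_rw 5 6 [← posPart_sub_negPart x]
  linear_combination 4 * this

/-- No nilpotents: `y² = 0` gives `0 ≤ (1 - n y)² = 1 - 2 n y` for every `n`, and the Archimedean
property applies. -/
theorem eq_zero_of_mul_self_nonpos {x : U} (h : x * x ≤ 0) : x = 0 := by
  have key : ∀ y : U, y * y ≤ 0 → y ≤ 0 := by
    intro y hy
    have h0 : y * y = 0 := le_antisymm hy (mul_self_nonneg_of_fRing y)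
    refine nonpos_of_nsmul_le (y := 1) fun n => ?_
    have h1 := mul_self_nonneg_of_fRing (1 - n • y)
    have h2 : 0 ≤ 1 - 2 * n • y := by
      have : (1 - n • y) * (1 - n • y) = 1 - 2 * n • y := by
        simp only [nsmul_eq_mul]
        linear_combination (n : U) ^ 2 * h0
      rwa [this] at h1
    rcases n.eq_zero_or_pos with rfl | hn
    · simp
    · have h3 : ∀ z : U, 2 * z ≤ 1 → z ≤ 1 := by
        intro z hz
        have : (2 : ℕ) • (z - 1) ≤ 0 := by
          rw [nsmul_eq_mul]; push_cast
          have : (0 : U) ≤ 1 := zero_le_one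
          linear_combination hz + this
        -- Halving without real scalars: the positive part of `z - 1` is below twice its negative
        -- part, to which it is disjoint.
        have h5 : (z - 1) ≤ 0 := by
          have h6 : ((z - 1)⁺ + (z - 1)⁺) - ((z - 1)⁻ + (z - 1)⁻) ≤ 0 := by
            have h7 := posPart_sub_negPart (z - 1)
            have : ((z - 1)⁺ + (z - 1)⁺) - ((z - 1)⁻ + (z - 1)⁻) = (2 : ℕ) • (z - 1) := by
              rw [two_nsmul]; nth_rw 5 6 [← h7]; abel
            rwa [this]
          have h8 : (z - 1)⁺ ≤ (z - 1)⁻ + (z - 1)⁻ :=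
            (le_add_of_nonneg_left (posPart_nonneg _)).trans (sub_nonpos.1 h6)
          have h9 : ((z - 1)⁻ + (z - 1)⁻) ⊓ (z - 1)⁺ = 0 := by
            have : (z - 1)⁻ ⊓ (z - 1)⁺ = 0 := by
              rw [inf_comm]; exact posPart_inf_negPart_eq_zero _
            exact inf_eq_zero_add (posPart_nonneg _) (negPart_nonneg _) (negPart_nonneg _) this this
          rw [inf_eq_right.2 h8] at h9
          exact posPart_eq_zero.1 h9
        exact sub_nonpos.1 h5
      exact h3 _ (sub_nonneg.1 h2)
  refine le_antisymm (key x h) ?_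
  have := key (-x) (by simpa using h)
  simpa using this

theorem inf_eq_zero_of_mul_eq_zero {a b : U} (ha : 0 ≤ a) (hb : 0 ≤ b) (h : a * b = 0) :
    a ⊓ b = 0 := by
  have h0 : 0 ≤ a ⊓ b := le_inf ha hb
  refine eq_zero_of_mul_self_nonpos ?_
  rw [← h]
  exact mul_le_mul inf_le_left inf_le_right h0 ha

theorem idem_nonneg {p : U} (hp : p * p = p) : 0 ≤ p := hp ▸ mul_self_nonneg_of_fRing p

theorem idem_compl {p : U} (hp : p * p = p) : (1 - p) * (1 - p) = 1 - p := by
  linear_combination hp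

theorem idem_le_one {p : U} (hp : p * p = p) : p ≤ 1 :=
  sub_nonneg.1 (idem_nonneg (idem_compl hp))

theorem idem_mul {p q : U} (hp : p * p = p) (hq : q * q = q) : (p * q) * (p * q) = p * q := by
  linear_combination q * q * hp + p * hq

theorem idem_mul_le {p x : U} (hp : p * p = p) (hx : 0 ≤ x) : p * x ≤ x := by
  simpa using mul_le_mul_of_nonneg_right (idem_le_one hp) hx

/-- The component of `1` generated by `x⁺`; heuristically the indicator of `x > 0`. -/
noncomputable def posIdem (x : U) : U := sSup (Set.range fun n : ℕ => 1 ⊓ n • x⁺)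

theorem isLUB_posIdem (x : U) : IsLUB (Set.range fun n : ℕ => 1 ⊓ n • x⁺) (posIdem x) :=
  isLUB_csSup (Set.range_nonempty _) ⟨1, by rintro _ ⟨n, rfl⟩; exact inf_le_left⟩

theorem posIdem_nonneg (x : U) : 0 ≤ posIdem x :=
  (le_inf zero_le_one (nsmul_nonneg (posPart_nonneg x) 0)).trans
    ((isLUB_posIdem x).1 ⟨0, rfl⟩)

theorem posIdem_le_one (x : U) : posIdem x ≤ 1 :=
  (isLUB_posIdem x).2 (by rintro _ ⟨n, rfl⟩; exact inf_le_left)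

theorem posIdem_mul_eq_zero {x y : U} (hy : 0 ≤ y) (h : x⁺ * y = 0) : posIdem x * y = 0 := by
  refine mul_eq_zero_of_inf_eq_zero (le_antisymm ?_ (le_inf (posIdem_nonneg x) hy))
  refine (isLUB_inf_const (isLUB_posIdem x) y).2 ?_
  rintro _ ⟨_, ⟨n, rfl⟩, rfl⟩
  have h0 := inf_eq_zero_of_mul_eq_zero (posPart_nonneg x) hy h
  rw [← nsmul_inf_eq_zero (posPart_nonneg x) hy h0 n]
  exact inf_le_inf_right _ inf_le_right

/-- With `p = posIdem x`, all multiples of `c = (1 - p) ⊓ (1 ⊓ x⁺)` stay below `p`: inductively `(n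
+ 1) c ≤ p + (1 - p) = 1` and `(n + 1) c ≤ (n + 1) x⁺`. Hence `c ≤ 0`. -/
theorem compl_posIdem_mul (x : U) : (1 - posIdem x) * x⁺ = 0 := by
  have h1 : (1 - posIdem x) ⊓ (1 ⊓ x⁺) ≤ 0 := by
    have hp := posIdem_le_one x
    refine nonpos_of_nsmul_le (y := 1) fun n => ?_
    set c := (1 - posIdem x) ⊓ (1 ⊓ x⁺) with hc
    have hc0 : 0 ≤ c := le_inf (sub_nonneg.2 hp) (le_inf zero_le_one (posPart_nonneg x))
    suffices hs : n • c ≤ posIdem x from hs.trans hp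
    induction n with
    | zero => simpa using posIdem_nonneg x
    | succ n ih =>
      refine le_trans ?_ ((isLUB_posIdem x).1 ⟨n + 1, rfl⟩)
      refine le_inf ?_ (nsmul_le_nsmul_right (inf_le_right.trans inf_le_right) _)
      rw [succ_nsmul]
      have h2 : c ≤ 1 - posIdem x := inf_le_left
      linear_combination ih + h2
  have h2 : (1 - posIdem x) ⊓ x⁺ = 0 := by
    refine le_antisymm (le_trans ?_ h1)
      (le_inf (sub_nonneg.2 (posIdem_le_one x)) (posPart_nonneg x))
    have := posIdem_nonneg x
    refine le_inf inf_le_left (le_inf (inf_le_left.trans ?_) inf_le_right)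
    simpa using this
  exact mul_eq_zero_of_inf_eq_zero h2

theorem posIdem_mul_posPart (x : U) : posIdem x * x⁺ = x⁺ := by
  linear_combination -compl_posIdem_mul x

theorem posIdem_idem (x : U) : posIdem x * posIdem x = posIdem x := by
  have := posIdem_mul_eq_zero (x := x) (sub_nonneg.2 (posIdem_le_one x))
    (by rw [mul_comm]; exact compl_posIdem_mul x)
  linear_combination -this

theorem posIdem_mul (x : U) : posIdem x * x = x⁺ := by
  have h := posIdem_mul_eq_zero (x := x) (negPart_nonneg x) (posPart_mul_negPart x)
  have h2 := posIdem_mul_posPart x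
  nth_rw 2 [← posPart_sub_negPart x]
  linear_combination h2 - h

theorem compl_posIdem_mul_self (x : U) : (1 - posIdem x) * x = -x⁻ := by
  have h := posIdem_mul x
  have h2 := posPart_sub_negPart x
  linear_combination -h - h2

theorem compl_posIdem_mul_nonpos (x : U) : (1 - posIdem x) * x ≤ 0 := by
  rw [compl_posIdem_mul_self]
  exact neg_nonpos.2 (negPart_nonneg x)

theorem posIdem_mul_nonneg (x : U) : 0 ≤ posIdem x * x := by
  rw [posIdem_mul]; exact posPart_nonneg x

/-- If `p x ≤ 0` on the idempotent `p` then `p` is disjoint from `posIdem x`. -/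
theorem mul_posIdem_eq_zero {p x : U} (hp : p * p = p) (h : p * x ≤ 0) : p * posIdem x = 0 := by
  rw [mul_comm]
  refine posIdem_mul_eq_zero (idem_nonneg hp) ?_
  rw [← posIdem_mul]
  refine le_antisymm ?_ (mul_nonneg (posIdem_mul_nonneg x) (idem_nonneg hp))
  have := mul_le_mul_of_nonneg_left h (posIdem_nonneg x)
  linear_combination this

theorem mul_nonpos_of_mul_posIdem {p x : U} (hp : p * p = p) (h : p * posIdem x = 0) :
    p * x ≤ 0 := by
  have := mul_le_mul_of_nonneg_left (compl_posIdem_mul_nonpos x) (idem_nonneg hp)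
  linear_combination this + x * h

theorem nonpos_of_posIdem_eq_zero {x : U} (h : posIdem x = 0) : x ≤ 0 := by
  have := compl_posIdem_mul_nonpos x
  simpa [h] using this

variable [Algebra ℝ U] [IsOrderedModule ℝ U]

theorem le_of_forall_smul_one {x : U} (h : ∀ δ : ℝ, 0 < δ → x ≤ δ • 1) : x ≤ 0 := by
  refine nonpos_of_nsmul_le (y := 1) fun n => ?_
  rcases n.eq_zero_or_pos with rfl | hn
  · simp
  · have hn' : (0 : ℝ) < n := by exact_mod_cast hn
    have h1 := h (1 / n) (by positivity)
    have h2 : (n : ℝ) • x ≤ (n : ℝ) • ((1 / n : ℝ) • (1 : U)) := smul_le_smul_of_nonneg_left h1 hn'.le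
    rw [smul_smul, mul_one_div_cancel hn'.ne', one_smul] at h2
    simpa [Nat.cast_smul_eq_nsmul] using h2

theorem idem_eq_zero_of_smul_nonpos {q : U} (hq : q * q = q) {s : ℝ} (hs : 0 < s)
    (h : s • q ≤ 0) : q = 0 := by
  refine le_antisymm ?_ (idem_nonneg hq)
  have : s⁻¹ • (s • q) ≤ s⁻¹ • (0 : U) := smul_le_smul_of_nonneg_left h (inv_pos.2 hs).le
  simpa [smul_smul, inv_mul_cancel₀ hs.ne'] using this

/-- To prove `x ≤ y` it is enough to exclude that `x - y` exceeds a positive real number on some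
nonzero idempotent. -/
theorem le_of_forall_idem {x y : U}
    (h : ∀ (q : U) (s : ℝ), q * q = q → 0 < s → s • q ≤ q * (x - y) → q = 0) : x ≤ y := by
  rw [← sub_nonpos]
  refine le_of_forall_smul_one fun δ hδ => ?_
  rw [← sub_nonpos]
  refine nonpos_of_posIdem_eq_zero (h _ δ (posIdem_idem _) hδ ?_)
  have := posIdem_mul_nonneg (x - y - δ • (1 : U))
  rw [mul_sub, mul_smul_comm, mul_one] at this
  exact sub_nonneg.1 this

theorem idem_restrict {q q' x : U} {s : ℝ} (hq' : q' * q' = q') (hle : q' * q = q')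
    (h : s • q ≤ q * x) : s • q' ≤ q' * x := by
  have := mul_le_mul_of_nonneg_left h (idem_nonneg hq')
  rw [mul_smul_comm, ← mul_assoc, hle] at this
  exact this

/-- Every element is bounded above on some nonzero part of a given nonzero idempotent. -/
theorem exists_idem_bound (x : U) {q : U} (hq : q * q = q) (h0 : q ≠ 0) :
    ∃ q' : U, q' * q' = q' ∧ q' ≠ 0 ∧ q' * q = q' ∧ ∃ N : ℝ, 0 < N ∧ q' * x ≤ N • q' := by
  by_contra! hcon
  apply h0
  refine le_antisymm (nonpos_of_nsmul_le (y := q * x) fun n => ?_) (idem_nonneg hq)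
  have hn' : (0 : ℝ) < (n + 1 : ℕ) := by positivity
  -- If no part of `q` admits the bound `n + 1`, then `x ≥ n + 1` on all of `q`, so `q * x`
  -- dominates every multiple of `q`. The shift keeps the bound positive at `n = 0`.
  set r := posIdem (x - ((n + 1 : ℕ) : U)) with hr
  have hz : q * (1 - r) = 0 := by
    by_contra hz
    refine hcon (q * (1 - r)) (idem_mul hq (idem_compl (posIdem_idem _))) hz
      (by linear_combination (1 - r) * hq) (n + 1 : ℕ) hn' ?_
    have := mul_le_mul_of_nonneg_left (compl_posIdem_mul_nonpos (x - ((n + 1 : ℕ) : U)))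
      (idem_nonneg hq)
    rw [← hr] at this
    rw [Nat.cast_smul_eq_nsmul, nsmul_eq_mul]
    linear_combination this
  have := mul_nonneg (idem_nonneg hq) (posIdem_mul_nonneg (x - ((n + 1 : ℕ) : U)))
  have hq0 := idem_nonneg hq
  rw [← hr] at this
  rw [nsmul_eq_mul]
  push_cast at this hz
  linear_combination this + hq0 - (x - ((n : U) + 1)) * hz

/-- Multiplication by a positive element preserves suprema. -/
theorem isLUB_mul_left {D : Set U} {x a : U} (ha : 0 ≤ a) (h : IsLUB D x) :
    IsLUB ((fun d => a * d) '' D) (a * x) := by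
  constructor
  · rintro _ ⟨d, hd, rfl⟩
    exact mul_le_mul_of_nonneg_left (h.1 hd) ha
  · intro b hb
    refine le_of_forall_idem fun q s hq hs hle => ?_
    by_contra h0
    obtain ⟨q', hq', h0', hqq, N, hN, hNa⟩ := exists_idem_bound a hq h0
    have hle' := idem_restrict hq' hqq hle
    apply h0'
    -- On `q'` one has `s ≤ a x - b ≤ a (x - d) ≤ N (x - d)`, so the supremum `x` could be lowered
    -- there by `s / N`.
    have key : x ≤ x - (N⁻¹ * s) • q' := by
      refine h.2 fun d hd => ?_
      have h1 : a * d ≤ b := hb ⟨d, hd, rfl⟩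
      have hxd : 0 ≤ x - d := sub_nonneg.2 (h.1 hd)
      have h2 : s • q' ≤ N • (q' * (x - d)) := by
        have e1 := mul_le_mul_of_nonneg_left h1 (idem_nonneg hq')
        have e2 := mul_le_mul_of_nonneg_right hNa hxd
        rw [smul_mul_assoc] at e2
        linear_combination hle' + e1 + e2
      have h3 : (N⁻¹ * s) • q' ≤ q' * (x - d) := by
        have := smul_le_smul_of_nonneg_left h2 (inv_pos.2 hN).le
        rwa [smul_smul, smul_smul, inv_mul_cancel₀ hN.ne', one_smul] at this
      have h4 := idem_mul_le hq' hxd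
      linear_combination h3 + h4
    exact idem_eq_zero_of_smul_nonpos hq' (by positivity : 0 < N⁻¹ * s) (by simpa using key)

/-- An element is constant up to `δ` on some nonzero part of a given nonzero idempotent. -/
theorem exists_idem_approx (x : U) {q : U} (hq : q * q = q) (h0 : q ≠ 0) {δ : ℝ} (hδ : 0 < δ) :
    ∃ (q' : U) (t : ℝ), q' * q' = q' ∧ q' ≠ 0 ∧ q' * q = q' ∧
      (t - δ) • q' ≤ q' * x ∧ q' * x ≤ (t + δ) • q' := by
  obtain ⟨q1, hq1, h01, hqq1, N, hN, hNx⟩ := exists_idem_bound x hq h0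
  obtain ⟨q2, hq2, h02, hqq2, M, hM, hMx⟩ := exists_idem_bound (-x) hq1 h01
  have hNx2 : q2 * x ≤ N • q2 := by
    have := mul_le_mul_of_nonneg_left hNx (idem_nonneg hq2)
    rwa [mul_smul_comm, ← mul_assoc, hqq2] at this
  -- The constant is the supremum of the real lower bounds of `x` on `q2`. The part where `x` stays
  -- below `sSup A + δ` is nonzero, since otherwise `sSup A + δ` would be such a lower bound.
  set A : Set ℝ := {t | t • q2 ≤ q2 * x}
  have hA : A.Nonempty := ⟨-M, by
    change (-M) • q2 ≤ q2 * x
    rw [neg_smul]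
    linear_combination hMx⟩
  have hAb : BddAbove A := ⟨N, fun t ht => by
    by_contra! hlt
    apply h02
    refine idem_eq_zero_of_smul_nonpos hq2 (sub_pos.2 hlt) ?_
    rw [sub_smul]
    exact sub_nonpos.2 (le_trans ht hNx2)⟩
  obtain ⟨a, haA, hat⟩ := exists_lt_of_lt_csSup hA (sub_lt_self (sSup A) hδ)
  have hlow : (sSup A - δ) • q2 ≤ q2 * x :=
    (smul_le_smul_of_nonneg_right hat.le (idem_nonneg hq2)).trans haA
  set r := posIdem ((sSup A + δ) • (1 : U) - x) with hr
  have hri : r * r = r := posIdem_idem _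
  have hq'i := idem_mul hq2 hri
  refine ⟨q2 * r, sSup A, hq'i, ?_, ?_, ?_, ?_⟩
  · intro hz
    have h1 : sSup A + δ ∈ A := by
      have := mul_nonpos_of_mul_posIdem hq2 hz
      rw [mul_sub, mul_smul_comm, mul_one] at this
      exact sub_nonpos.1 this
    have := le_csSup hAb h1
    linarith
  · linear_combination -(r * q) * hqq2 + r * q2 * hqq1 + r * hqq2
  · have := mul_le_mul_of_nonneg_left hlow (idem_nonneg hri)
    rw [mul_smul_comm, mul_comm r q2] at this
    linear_combination this
  · have := mul_nonneg (idem_nonneg hq2) (posIdem_mul_nonneg ((sSup A + δ) • (1 : U) - x))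
    rw [← hr, mul_sub, mul_smul_comm, mul_one, mul_sub, mul_smul_comm] at this
    linear_combination this

end FRing

/-! ### Square roots, order boundedness and inverses. -/

section FRing

variable {U : Type*} [ConditionallyCompleteLattice U] [CommRing U] [IsOrderedRing U] [IsFRing U]

/-- On the component `p` where `r > s`, `p (r - s)² = p (r² - s²) - 2 p (r - s) s ≤ 0`. -/
theorem le_of_mul_self_le {r s : U} (hs : 0 ≤ s) (h : r * r ≤ s * s) : r ≤ s := by
  have h1 : (r - s)⁺ * (r - s)⁺ ≤ 0 := by
    have hp := posIdem_idem (r - s)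
    have hd := posIdem_mul (r - s)
    have hd0 := posIdem_mul_nonneg (r - s)
    set p := posIdem (r - s)
    rw [← hd]
    have e1 := mul_nonneg hd0 hs
    have e2 := mul_le_mul_of_nonneg_left h (idem_nonneg hp)
    linear_combination e2 + e1 + e1 + (r - s) * (r - s) * hp
  exact sub_nonpos.1 (posPart_eq_zero.1 (eq_zero_of_mul_self_nonpos h1))

theorem sup_eq_posIdem (r s : U) :
    r ⊔ s = posIdem (r - s) * r + (1 - posIdem (r - s)) * s := by
  have h := posIdem_mul (r - s)
  have h2 : r ⊔ s = (r - s)⁺ + s := by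
    rw [posPart_def, sup_add]; simp
  rw [h2, ← h]; ring

theorem mul_self_sup_le {r s a : U} (hr : r * r ≤ a) (hs : s * s ≤ a) :
    (r ⊔ s) * (r ⊔ s) ≤ a := by
  rw [sup_eq_posIdem]
  have hp := posIdem_idem (r - s)
  set p := posIdem (r - s)
  have e1 := mul_le_mul_of_nonneg_left hr (idem_nonneg hp)
  have e2 := mul_le_mul_of_nonneg_left hs (idem_nonneg (idem_compl hp))
  linear_combination e1 + e2 + (r - s) * (r - s) * hp

variable [Algebra ℝ U] [IsOrderedModule ℝ U]

/-- `x²` is the supremum of its tangents `2 t x - t²`. -/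
theorem mul_self_le_of_forall_tangent {x y : U}
    (h : ∀ t : ℝ, (2 * t) • x - (t * t) • (1 : U) ≤ y) : x * x ≤ y := by
  refine le_of_forall_idem fun q s hq hs hle => ?_
  by_contra h0
  -- The precision makes `(x - t)² ≤ s / 2` on `q'`, less than the assumed gap `s` between `x²` and
  -- its tangent at `t`.
  obtain ⟨q', t, hq', h0', hqq, h1, h2⟩ :=
    exists_idem_approx x hq h0 (Real.sqrt_pos.2 (half_pos hs))
  set δ := Real.sqrt (s / 2)
  have hδ : δ * δ = s / 2 := Real.mul_self_sqrt (half_pos hs).le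
  have hle' := idem_restrict hq' hqq hle
  apply h0'
  refine idem_eq_zero_of_smul_nonpos hq' (half_pos hs) ?_
  have e1 := mul_le_mul_of_nonneg_left (h t) (idem_nonneg hq')
  have e2 : 0 ≤ (q' * x - (t - δ) • q') * ((t + δ) • q' - q' * x) :=
    mul_nonneg (sub_nonneg.2 h1) (sub_nonneg.2 h2)
  have e3 : (q' * x - (t - δ) • q') * ((t + δ) • q' - q' * x) =
      (δ * δ) • q' - q' * (x * x - (2 * t) • x + (t * t) • (1 : U)) := by
    simp only [Algebra.smul_def, map_add, map_sub, map_mul, map_ofNat]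
    linear_combination (-(algebraMap ℝ U t) * (algebraMap ℝ U t) + (algebraMap ℝ U δ) * (algebraMap ℝ U δ)
      + 2 * algebraMap ℝ U t * x - x * x) * hq'
  rw [e3, hδ] at e2
  have e4 : s • q' = (s / 2) • q' + (s / 2) • q' := by rw [← add_smul]; ring_nf
  rw [e4] at hle'
  simp only [mul_sub, mul_add] at *
  linear_combination hle' + e1 + e2

/-- Positive elements have positive square roots. -/
theorem exists_sqrt {a : U} (ha : 0 ≤ a) : ∃ r : U, 0 ≤ r ∧ r * r = a := by
  set R : Set U := {r | 0 ≤ r ∧ r * r ≤ a}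
  have hR0 : (0 : U) ∈ R := ⟨le_rfl, by simpa using ha⟩
  have hRb : BddAbove R := ⟨1 + a, fun r hr => by
    refine le_of_mul_self_le (add_nonneg zero_le_one ha) ?_
    have h1 := hr.2
    have h2 := mul_nonneg ha ha
    have h3 : (0 : U) ≤ 1 := zero_le_one
    linear_combination h1 + h2 + h3 + ha⟩
  set b := sSup R
  have hb : IsLUB R b := isLUB_csSup ⟨0, hR0⟩ hRb
  have hb0 : 0 ≤ b := hb.1 hR0
  have hbb : b * b ≤ a := by
    -- The supremum is taken in one factor at a time; mixed products satisfy `r s ≤ (r ⊔ s)² ≤ a`.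
    refine (isLUB_mul_left hb0 hb).2 ?_
    rintro _ ⟨r, hr, rfl⟩
    change b * r ≤ a
    rw [mul_comm]
    refine (isLUB_mul_left hr.1 hb).2 ?_
    rintro _ ⟨s, hs, rfl⟩
    refine le_trans ?_ (mul_self_sup_le hr.2 hs.2)
    exact mul_le_mul le_sup_left le_sup_right hs.1 (hr.1.trans le_sup_left)
  refine ⟨b, hb0, le_antisymm hbb ?_⟩
  refine le_of_forall_idem fun q s hq hs hle => ?_
  by_contra h0
  obtain ⟨q', hq', h0', hqq, N, hN, hNb⟩ := exists_idem_bound b hq h0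
  have hle' := idem_restrict hq' hqq hle
  -- Raising `b` by `η` on `q'`, where `b ≤ N`, adds at most `2 η N + η²` to the square; this must
  -- fit into the gap `s`.
  obtain ⟨η, hη, hηs⟩ : ∃ η : ℝ, 0 < η ∧ 2 * η * N + η * η ≤ s := by
    refine ⟨min 1 (s / (2 * N + 1)), by positivity, ?_⟩
    set η := min 1 (s / (2 * N + 1))
    have h1 : η ≤ 1 := min_le_left _ _
    have h2 : η ≤ s / (2 * N + 1) := min_le_right _ _
    have h3 : 0 < η := by positivity
    rw [le_div_iff₀ (by positivity)] at h2
    nlinarith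
  have hmem : b + η • q' ∈ R := by
    have hηq : 0 ≤ η • q' := smul_nonneg hη.le (idem_nonneg hq')
    refine ⟨add_nonneg hb0 hηq, ?_⟩
    have e1 := smul_le_smul_of_nonneg_left hNb (by positivity : 0 ≤ 2 * η)
    have e2 := smul_le_smul_of_nonneg_right hηs (idem_nonneg hq')
    have e3 := mul_le_mul_of_nonneg_left hbb (idem_nonneg (idem_compl hq'))
    have e4 : (b + η • q') * (b + η • q') = b * b + (2 * η) • (q' * b) + (η * η) • q' := by
      simp only [Algebra.smul_def, map_mul, map_ofNat]
      linear_combination algebraMap ℝ U η * algebraMap ℝ U η * hq'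
    rw [e4]
    rw [smul_smul] at e1
    rw [add_smul] at e2
    linear_combination e1 + e2 + hle' + e3
  apply h0'
  refine idem_eq_zero_of_smul_nonpos hq' hη ?_
  simpa using hb.1 hmem

/-- The universal completeness of laterally complete spaces: a set of positive elements that is
unbounded on no nonzero idempotent is bounded. -/
theorem bddAbove_of_laterallyComplete
    (hlat : ∀ s : Set U, s.Nonempty → (∀ x ∈ s, 0 ≤ x) →
      s.Pairwise (fun x y => x ⊓ y = 0) → ∃ l, IsLUB s l)
    {D : Set U} (hD : D.Nonempty) (hD0 : ∀ d ∈ D, 0 ≤ d)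
    (h : ∀ q : U, q * q = q →
      (∀ n : ℕ, n • q ≤ sSup ((fun d => d ⊓ ((n : ℕ) : U)) '' D)) → q = 0) : BddAbove D := by
  have hs : ∀ n : ℕ, IsLUB ((fun d => d ⊓ ((n : ℕ) : U)) '' D)
      (sSup ((fun d => d ⊓ ((n : ℕ) : U)) '' D)) := fun n =>
    isLUB_csSup (hD.image _) ⟨n, by rintro _ ⟨d, _, rfl⟩; exact inf_le_right⟩
  set s : ℕ → U := fun n => sSup ((fun d => d ⊓ ((n : ℕ) : U)) '' D) with hsdef
  have hsn : ∀ n, s n ≤ n := fun n =>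
    (hs n).2 (by rintro _ ⟨d, _, rfl⟩; exact inf_le_right)
  -- On `p n` all of `D` stays below `n`; on `p n * c n`, with `c` defined below, `n` is the first
  -- such bound. These pieces are disjoint, so lateral completeness glues the constants `n` on them
  -- into one bound `l`.
  set p : ℕ → U := fun n => posIdem ((n : U) - s n) with hpdef
  have hp : ∀ n, p n * p n = p n := fun n => posIdem_idem _
  have hpd : ∀ n, ∀ d ∈ D, p n * d ≤ p n * (n : U) := by
    intro n d hd
    have ht := posIdem_idem (d - (n : U))
    have htm := posIdem_mul (d - (n : U))
    have htc := compl_posIdem_mul_nonpos (d - (n : U))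
    set t := posIdem (d - (n : U))
    have h1 : d ⊓ (n : U) = d - (d - (n : U))⁺ := by
      rw [posPart_def, sub_sup]; simp [inf_comm]
    have h2 : t * ((n : U) - s n) ≤ 0 := by
      have h3 : d ⊓ (n : U) ≤ s n := (hs n).1 ⟨d, hd, rfl⟩
      have h4 := mul_le_mul_of_nonneg_left h3 (idem_nonneg ht)
      rw [h1, ← htm] at h4
      linear_combination h4 + (d - n) * ht
    have h5 := mul_posIdem_eq_zero ht h2
    have h6 := mul_le_mul_of_nonneg_left htc (idem_nonneg (hp n))
    have h5' : t * p n = 0 := h5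
    linear_combination h6 + (d - n) * h5'
  set c : ℕ → U := fun n => ∏ k ∈ Finset.range n, (1 - p k) with hcdef
  have hc : ∀ n, c n * c n = c n := fun n => by
    rw [hcdef, ← Finset.prod_mul_distrib]
    exact Finset.prod_congr rfl fun k _ => idem_compl (hp k)
  have hcp : ∀ k n, k < n → p k * c n = 0 := fun k n hkn => by
    rw [hcdef]
    change p k * ∏ k ∈ Finset.range n, (1 - p k) = 0
    rw [← Finset.mul_prod_erase _ _ (Finset.mem_range.2 hkn), ← mul_assoc]
    have : p k * (1 - p k) = 0 := by linear_combination -hp k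
    rw [this, zero_mul]
  have hdisj : ∀ k n : ℕ, k < n → ((k : ℕ) : U) * (p k * c k) * (((n : ℕ) : U) * (p n * c n)) = 0 := fun k n hkn => by
    linear_combination k * n * c k * p n * hcp k n hkn
  have hpc : ∀ n, (p n * c n) * (p n * c n) = p n * c n := fun n => idem_mul (hp n) (hc n)
  have hnn : ∀ n : ℕ, 0 ≤ (n : U) * (p n * c n) := fun n =>
    mul_nonneg n.cast_nonneg (idem_nonneg (hpc n))
  obtain ⟨l, hl⟩ := hlat (Set.range fun n : ℕ => (n : U) * (p n * c n)) (Set.range_nonempty _)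
    (by rintro _ ⟨n, rfl⟩; exact hnn n) (by
      rintro _ ⟨k, rfl⟩ _ ⟨n, rfl⟩ hkn
      refine inf_eq_zero_of_mul_eq_zero (hnn k) (hnn n) ?_
      rcases lt_trichotomy k n with hlt | rfl | hlt
      · exact hdisj k n hlt
      · exact absurd rfl hkn
      · rw [mul_comm]; exact hdisj n k hlt)
  refine ⟨l, fun d hd => le_of_forall_idem fun q σ hq hσ hle => ?_⟩
  -- On the piece with first bound `n` one has `d ≤ n ≤ l`, so a `q` on which `d` exceeds `l` misses
  -- every piece. Hence it misses every `p n`, so the truncated suprema `s n` reach `n` on `q`, and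
  -- the hypothesis gives `q = 0`.
  have hqc : ∀ n, q * (p n * c n) = 0 := fun n => by
    have hq' := idem_mul hq (hpc n)
    refine idem_eq_zero_of_smul_nonpos hq' hσ ?_
    refine (idem_restrict hq' (by linear_combination (p n * c n) * hq) hle).trans ?_
    have e1 : (n : U) * (p n * c n) ≤ l := hl.1 ⟨n, rfl⟩
    have e2 := mul_le_mul_of_nonneg_left e1 (idem_nonneg hq')
    have e3 := mul_le_mul_of_nonneg_left (hpd n d hd) (mul_nonneg (idem_nonneg hq)
      (idem_nonneg (hc n)))
    linear_combination e2 + e3 - (q * n) * hpc n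
  have hqc' : ∀ n, q * c n = q := fun n => by
    induction n with
    | zero => simp [hcdef]
    | succ n ih =>
      have : c (n + 1) = c n * (1 - p n) := Finset.prod_range_succ _ _
      rw [this]
      linear_combination ih - hqc n
  refine h q hq fun n => ?_
  have h1 : q * p n = 0 := by linear_combination hqc n - p n * hqc' n
  have h2 := mul_nonpos_of_mul_posIdem hq h1
  have h3 : 0 ≤ s n → q * s n ≤ s n := idem_mul_le hq
  have h4 : n • q ≤ q * s n := by
    rw [nsmul_eq_mul]
    linear_combination h2
  have h5 : 0 ≤ q * s n := le_trans (nsmul_nonneg (idem_nonneg hq) n) h4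
  obtain ⟨d, hd⟩ := hD
  exact h4.trans (h3 (le_trans (le_inf (hD0 d hd) n.cast_nonneg) ((hs n).1 ⟨d, hd, rfl⟩)))

/-- In a laterally complete `f`-ring, positive weak order units are invertible. -/
theorem exists_inverse
    (hlat : ∀ s : Set U, s.Nonempty → (∀ x ∈ s, 0 ≤ x) →
      s.Pairwise (fun x y => x ⊓ y = 0) → ∃ l, IsLUB s l)
    {v : U} (hv : 0 ≤ v) (h : ∀ q : U, q * q = q → q * v = 0 → q = 0) :
    ∃ w : U, 0 ≤ w ∧ v * w = 1 := by
  set W : Set U := {w | 0 ≤ w ∧ v * w ≤ 1}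
  have hW0 : (0 : U) ∈ W := ⟨le_rfl, by simp⟩
  have hWb : BddAbove W := by
    -- Multiplying `n q ≤ sup (w ⊓ n)` by `v` gives `n (q v) ≤ 1` for all `n`, so `q v = 0`.
    refine bddAbove_of_laterallyComplete hlat ⟨0, hW0⟩ (fun w hw => hw.1) fun q hq hn => ?_
    refine h q hq (le_antisymm (nonpos_of_nsmul_le (y := 1) fun n => ?_)
      (mul_nonneg (idem_nonneg hq) hv))
    have h1 := mul_le_mul_of_nonneg_left (hn n) hv
    have h2 : IsLUB ((fun d => d ⊓ ((n : ℕ) : U)) '' W)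
        (sSup ((fun d => d ⊓ ((n : ℕ) : U)) '' W)) :=
      isLUB_csSup ⟨_, 0, hW0, rfl⟩ ⟨n, by rintro _ ⟨d, _, rfl⟩; exact inf_le_right⟩
    have h3 : v * sSup ((fun d => d ⊓ ((n : ℕ) : U)) '' W) ≤ 1 := by
      refine (isLUB_mul_left hv h2).2 ?_
      rintro _ ⟨_, ⟨w, hw, rfl⟩, rfl⟩
      exact (mul_le_mul_of_nonneg_left inf_le_left hv).trans hw.2
    refine le_trans (le_of_eq ?_) (h1.trans h3)
    simp only [nsmul_eq_mul]; ring
  have hw : IsLUB W (sSup W) := isLUB_csSup ⟨0, hW0⟩ hWb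
  set w := sSup W
  have hvw : v * w ≤ 1 := by
    refine (isLUB_mul_left hv hw).2 ?_
    rintro _ ⟨w, hw, rfl⟩
    exact hw.2
  have hw0 : 0 ≤ w := hw.1 hW0
  refine ⟨w, hw0, le_antisymm hvw ?_⟩
  refine le_of_forall_idem fun q s hq hs hle => ?_
  by_contra h0
  obtain ⟨q', hq', h0', hqq, N, hN, hNv⟩ := exists_idem_bound v hq h0
  have hle' := idem_restrict hq' hqq hle
  have hη : 0 < N⁻¹ * s := by positivity
  -- Where `v ≤ N` and `1 - v w ≥ s`, the maximal `w` could still be raised by `s / N`.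
  have hmem : w + (N⁻¹ * s) • q' ∈ W := by
    refine ⟨add_nonneg hw0 (smul_nonneg hη.le (idem_nonneg hq')), ?_⟩
    have e1 := smul_le_smul_of_nonneg_left hNv hη.le
    rw [smul_smul, mul_right_comm, inv_mul_cancel₀ hN.ne', one_mul] at e1
    have e2 := mul_le_mul_of_nonneg_left hvw (idem_nonneg (idem_compl hq'))
    rw [mul_add, mul_smul_comm, mul_comm v q']
    linear_combination e1 + e2 + hle'
  apply h0'
  refine idem_eq_zero_of_smul_nonpos hq' hη ?_
  simpa using hw.1 hmem

end FRing

/-! ### Conditional operators on an ideal: Jensen, averaging, best approximation. -/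

section FRing

variable {U : Type*} [ConditionallyCompleteLattice U] [CommRing U] [IsOrderedRing U] [IsFRing U]
  [Algebra ℝ U] [IsOrderedModule ℝ U]

/-- An order ideal containing the unit. -/
structure IsUnitalIdeal (V : Submodule ℝ U) : Prop where
  one_mem : (1 : U) ∈ V
  of_le : ∀ x ∈ V, ∀ y, 0 ≤ y → y ≤ x → y ∈ V
  posPart_mem : ∀ x ∈ V, x⁺ ∈ V

/-- A strictly positive order continuous unital projection acting on the order ideal `V`. -/
structure CondOp (V : Submodule ℝ U) (T : U →ₗ[ℝ] U) : Prop where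
  mem : ∀ x ∈ V, T x ∈ V
  nonneg : ∀ x ∈ V, 0 ≤ x → 0 ≤ T x
  strict : ∀ x ∈ V, 0 ≤ x → T x = 0 → x = 0
  idem : ∀ x ∈ V, T (T x) = T x
  map_one : T 1 = 1
  cont : ∀ D : Set U, D ⊆ V → D.Nonempty → DirectedOn (· ≤ ·) D → ∀ x ∈ V, IsLUB D x →
    IsLUB (T '' D) (T x)

/-- `V` is the natural domain of `T`. -/
def IsMaximalDomain (V : Submodule ℝ U) (T : U →ₗ[ℝ] U) : Prop :=
  ∀ D : Set U, D ⊆ V → D.Nonempty → DirectedOn (· ≤ ·) D → (∀ x ∈ D, 0 ≤ x) →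
    BddAbove (T '' D) → ∀ u, IsLUB D u → u ∈ V

namespace IsUnitalIdeal

variable {V : Submodule ℝ U} (hV : IsUnitalIdeal V)
include hV

theorem mem_of_le_of_le {a b y : U} (ha : a ∈ V) (hb : b ∈ V) (h1 : a ≤ y) (h2 : y ≤ b) :
    y ∈ V := by
  have := hV.of_le (b - a) (V.sub_mem hb ha) (y - a) (sub_nonneg.2 h1) (sub_le_sub_right h2 a)
  simpa using V.add_mem this ha

theorem natCast_mem (n : ℕ) : (n : U) ∈ V := by
  simpa using V.nsmul_mem hV.one_mem n

theorem idem_mem {p : U} (hp : p * p = p) : p ∈ V :=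
  hV.of_le 1 hV.one_mem p (idem_nonneg hp) (idem_le_one hp)

theorem mul_mem_of_nonneg {k y : U} (hk : 0 ≤ k) (n : ℕ) (hkn : k ≤ n) (hy : y ∈ V)
    (hy0 : 0 ≤ y) : k * y ∈ V := by
  refine hV.of_le (n • y) (V.nsmul_mem hy n) _ (mul_nonneg hk hy0) ?_
  rw [nsmul_eq_mul]
  exact mul_le_mul_of_nonneg_right hkn hy0

theorem negPart_mem {x : U} (hx : x ∈ V) : x⁻ ∈ V := by
  have := V.sub_mem (hV.posPart_mem x hx) hx
  convert this using 1
  nth_rw 3 [← posPart_sub_negPart x]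
  abel

theorem idem_mul_mem {p x : U} (hp : p * p = p) (hx : x ∈ V) : p * x ∈ V := by
  have h1 := hV.mul_mem_of_nonneg (idem_nonneg hp) 1 (by simpa using idem_le_one hp)
    (hV.posPart_mem x hx) (posPart_nonneg x)
  have h2 := hV.mul_mem_of_nonneg (idem_nonneg hp) 1 (by simpa using idem_le_one hp)
    (hV.negPart_mem hx) (negPart_nonneg x)
  have := V.sub_mem h1 h2
  rwa [← mul_sub, posPart_sub_negPart] at this

theorem mem_of_two_mul {x y : U} (hy : y ∈ V) (h1 : -y ≤ 2 * x) (h2 : 2 * x ≤ y) : x ∈ V := by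
  have := V.smul_mem (2⁻¹ : ℝ) (hV.mem_of_le_of_le (V.neg_mem hy) hy h1 h2)
  have h3 : (2 : U) * x = (2 : ℝ) • x := by rw [two_mul, two_smul]
  rwa [h3, smul_smul, inv_mul_cancel₀ two_ne_zero, one_smul] at this

theorem mul_mem {x y : U} (hx : x * x ∈ V) (hy : y * y ∈ V) : x * y ∈ V := by
  refine hV.mem_of_two_mul (V.add_mem hx hy) ?_ ?_
  · have := mul_self_nonneg_of_fRing (x + y)
    linear_combination this
  · have := mul_self_nonneg_of_fRing (x - y)
    linear_combination this

theorem mem_of_mul_self_mem {x : U} (hx : x * x ∈ V) : x ∈ V := by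
  have := hV.mul_mem hx (y := 1) (by simpa using hV.one_mem)
  simpa using this

theorem add_mul_self_mem {x y : U} (hx : x * x ∈ V) (hy : y * y ∈ V) :
    (x + y) * (x + y) ∈ V := by
  have : (x + y) * (x + y) = x * x + y * y + (x * y + x * y) := by ring
  rw [this]
  have := hV.mul_mem hx hy
  exact V.add_mem (V.add_mem hx hy) (V.add_mem this this)

theorem sub_mul_self_mem {x y : U} (hx : x * x ∈ V) (hy : y * y ∈ V) :
    (x - y) * (x - y) ∈ V := by
  have := hV.add_mul_self_mem hx (y := -y) (by simpa using hy)
  rwa [← sub_eq_add_neg] at this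

end IsUnitalIdeal

theorem isLUB_inf_natCast {y : U} : IsLUB (Set.range fun n : ℕ => y ⊓ (n : U)) y := by
  constructor
  · rintro _ ⟨n, rfl⟩
    exact inf_le_left
  · intro u hu
    refine le_of_forall_idem fun q s hq hs hle => ?_
    by_contra h0
    obtain ⟨q', hq', h0', hqq, N, hN, hNy⟩ := exists_idem_bound y hq h0
    obtain ⟨n, hn⟩ := exists_nat_ge N
    apply h0'
    refine idem_eq_zero_of_smul_nonpos hq' hs ((idem_restrict hq' hqq hle).trans ?_)
    have h1 : y ⊓ (n : U) = y - (y - (n : U))⁺ := by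
      rw [posPart_def, sub_sup]; simp [inf_comm]
    have h2 : y ⊓ (n : U) ≤ u := hu ⟨n, rfl⟩
    have h3 : q' * y ≤ n * q' := by
      refine hNy.trans ?_
      rw [← nsmul_eq_mul, ← Nat.cast_smul_eq_nsmul ℝ]
      exact smul_le_smul_of_nonneg_right hn (idem_nonneg hq')
    have h4 := posIdem_mul (y - (n : U))
    have h5 := mul_le_mul_of_nonneg_left h3 (posIdem_nonneg (y - (n : U)))
    have h6 := mul_le_mul_of_nonneg_left h2 (idem_nonneg hq')
    rw [h1, ← h4] at h6
    linear_combination h6 + h5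

theorem monotone_inf_natCast (y : U) : Monotone fun n : ℕ => y ⊓ (n : U) := fun m n h =>
  inf_le_inf_left _ (by exact_mod_cast Nat.mono_cast h)

namespace CondOp

variable {V : Submodule ℝ U} {T : U →ₗ[ℝ] U} (hT : CondOp V T) (hV : IsUnitalIdeal V)
include hT

theorem mono {x y : U} (hx : x ∈ V) (hy : y ∈ V) (h : x ≤ y) : T x ≤ T y := by
  have := hT.nonneg _ (V.sub_mem hy hx) (sub_nonneg.2 h)
  rwa [map_sub, sub_nonneg] at this

theorem isLUB_range {x : ℕ → U} (hx : ∀ n, x n ∈ V) (hm : Monotone x) {u : U} (hu : u ∈ V)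
    (h : IsLUB (Set.range x) u) : IsLUB (Set.range fun n => T (x n)) (T u) := by
  have := hT.cont _ (by rintro _ ⟨n, rfl⟩; exact hx n) (Set.range_nonempty x)
    (directedOn_range.2 hm.directed_le) u hu h
  rwa [← Set.range_comp] at this

/-- `T x - x` is positive and killed by `T`, so strictness makes it zero. One inequality thus
suffices to recognize fixed points such as `x⁺` and `k²` below. -/
theorem map_eq_of_le {x : U} (hx : x ∈ V) (h : x ≤ T x) : T x = x := by
  have := hT.strict (T x - x) (V.sub_mem (hT.mem x hx) hx) (sub_nonneg.2 h)
    (by rw [map_sub, hT.idem x hx, sub_self])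
  exact sub_eq_zero.1 this

theorem map_natCast (n : ℕ) : T n = n := by
  rw [← nsmul_one, map_nsmul, hT.map_one]

include hV

theorem map_posPart {x : U} (hx : x ∈ V) (h : T x = x) : T x⁺ = x⁺ := by
  have hp := hV.posPart_mem x hx
  refine hT.map_eq_of_le hp ?_
  refine sup_le ?_ (hT.nonneg _ hp (posPart_nonneg x))
  conv_lhs => rw [← h]
  exact hT.mono hx hp (le_posPart x)

theorem map_inf {x y : U} (hx : x ∈ V) (hy : y ∈ V) (h : T x = x) (h' : T y = y) :
    x ⊓ y ∈ V ∧ T (x ⊓ y) = x ⊓ y := by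
  have h1 : x ⊓ y = x - (x - y)⁺ := by
    rw [posPart_def, sub_sup]; simp [inf_comm]
  have hxy := V.sub_mem hx hy
  rw [h1, map_sub, hT.map_posPart hV hxy (by rw [map_sub, h, h']), h]
  exact ⟨V.sub_mem hx (hV.posPart_mem _ hxy), rfl⟩

/-- Jensen's inequality for the square: `T` is applied to each tangent `2 t x - t² ≤ x²`, and the
tangents at `T x` have supremum `(T x)²`. -/
theorem mul_self_map_le {x : U} (hx : x * x ∈ V) : T x * T x ≤ T (x * x) := by
  have hxV := hV.mem_of_mul_self_mem hx
  refine mul_self_le_of_forall_tangent fun t => ?_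
  have h1 : (2 * t) • x - (t * t) • (1 : U) ≤ x * x := by
    have := mul_self_nonneg_of_fRing (x - t • (1 : U))
    have e : (x - t • (1 : U)) * (x - t • (1 : U)) =
        x * x - ((2 * t) • x - (t * t) • (1 : U)) := by
      simp only [Algebra.smul_def, map_mul, map_ofNat]
      ring
    rw [e] at this
    exact sub_nonneg.1 this
  have := hT.mono (V.sub_mem (V.smul_mem _ hxV) (V.smul_mem _ hV.one_mem)) hx h1
  rwa [map_sub, map_smul, map_smul, hT.map_one] at this

theorem map_mul_self_mem {x : U} (hx : x * x ∈ V) : T x * T x ∈ V :=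
  hV.of_le _ (hT.mem _ hx) _ (mul_self_nonneg_of_fRing _) (hT.mul_self_map_le hV hx)

theorem map_mul_self {k : U} (hk : T k = k) (hkV : k * k ∈ V) : T (k * k) = k * k := by
  refine hT.map_eq_of_le hkV ?_
  have := hT.mul_self_map_le hV hkV
  rwa [hk] at this

/-- The averaging property for square integrable elements. -/
theorem map_mul_of_mul_self_mem {k y : U} (hk : T k = k) (hkV : k * k ∈ V) (hy : y * y ∈ V) :
    T (k * y) = k * T y := by
  have hky := hV.mul_mem hkV hy
  -- Jensen for `t k + y`: the `t²` terms cancel because `T (k²) = k²`. What remains is linear in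
  -- `t` with a bound independent of `t`, so its slope vanishes.
  have key : ∀ t : ℝ, (-(2 * t)) • (T (k * y) - k * T y) ≤ T (y * y) - T y * T y := by
    intro t
    have h1 : (t • k) * (t • k) ∈ V := by
      rw [smul_mul_smul_comm]; exact V.smul_mem _ hkV
    have h2 := hT.mul_self_map_le hV (hV.add_mul_self_mem h1 hy)
    have e : (t • k + y) * (t • k + y) = (t * t) • (k * k) + (2 * t) • (k * y) + y * y := by
      simp only [Algebra.smul_def, map_mul, map_ofNat]
      ring
    rw [e, map_add, map_add, map_add, map_smul, map_smul, map_smul, hT.map_mul_self hV hk hkV,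
      hk] at h2
    have e2 : (t • k + T y) * (t • k + T y) =
        (t * t) • (k * k) + (2 * t) • (k * T y) + T y * T y := by
      simp only [Algebra.smul_def, map_mul, map_ofNat]
      ring
    rw [e2] at h2
    rw [neg_smul, smul_sub]
    linear_combination h2
  refine sub_eq_zero.1 (le_antisymm (nonpos_of_nsmul_le (y := T (y * y) - T y * T y) fun n => ?_)
    (neg_nonpos.1 (nonpos_of_nsmul_le (y := T (y * y) - T y * T y) fun n => ?_)))
  · have := key (-(n / 2))
    rw [← Nat.cast_smul_eq_nsmul ℝ]
    convert this using 2
    ring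
  · have := key (n / 2)
    rw [← Nat.cast_smul_eq_nsmul ℝ, smul_neg, ← neg_smul]
    convert this using 2
    ring

/-- Truncating `y` at `n` makes it square integrable; order continuity removes the truncation. -/
theorem map_mul_of_le_natCast {k y : U} (hk : T k = k) (hk0 : 0 ≤ k) {N : ℕ} (hkN : k ≤ N)
    (hy : y ∈ V) (hy0 : 0 ≤ y) : T (k * y) = k * T y := by
  have hkky := hV.mul_mem_of_nonneg hk0 N hkN hy hy0
  have hn0 : ∀ n : ℕ, 0 ≤ y ⊓ (n : U) := fun n => le_inf hy0 n.cast_nonneg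
  have hnV : ∀ n : ℕ, y ⊓ (n : U) ∈ V := fun n => hV.of_le y hy _ (hn0 n) inf_le_left
  have hkV : k ∈ V := hV.of_le _ (hV.natCast_mem N) _ hk0 hkN
  have hkk : k * k ∈ V := hV.mul_mem_of_nonneg hk0 N hkN hkV hk0
  have h1 : IsLUB (Set.range fun n : ℕ => T (k * (y ⊓ (n : U)))) (T (k * y)) := by
    refine hT.isLUB_range (fun n => hV.mul_mem_of_nonneg hk0 N hkN (hnV n) (hn0 n))
      ((monotone_inf_natCast y).const_mul hk0) hkky ?_
    have := isLUB_mul_left hk0 (isLUB_inf_natCast (y := y))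
    rwa [← Set.range_comp] at this
  have h2 : IsLUB (Set.range fun n : ℕ => k * T (y ⊓ (n : U))) (k * T y) := by
    have := isLUB_mul_left hk0
      (hT.isLUB_range hnV (monotone_inf_natCast y) hy (isLUB_inf_natCast (y := y)))
    rwa [← Set.range_comp] at this
  have h3 : (fun n : ℕ => T (k * (y ⊓ (n : U)))) = fun n : ℕ => k * T (y ⊓ (n : U)) := by
    funext n
    refine hT.map_mul_of_mul_self_mem hV hk hkk ?_
    exact hV.mul_mem_of_nonneg (hn0 n) n inf_le_right (hnV n) (hn0 n)
  rw [h3] at h1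
  exact h1.unique h2

theorem map_idem_mul {p y : U} (hp : p * p = p) (hTp : T p = p) (hy : y ∈ V) :
    T (p * y) = p * T y := by
  have h1 : p ≤ (1 : ℕ) := by simpa using idem_le_one hp
  rw [← posPart_sub_negPart y, mul_sub, map_sub, map_sub, mul_sub,
    hT.map_mul_of_le_natCast hV hTp (idem_nonneg hp) h1 (hV.posPart_mem y hy) (posPart_nonneg y),
    hT.map_mul_of_le_natCast hV hTp (idem_nonneg hp) h1 (hV.negPart_mem hy) (negPart_nonneg y)]

/-- Here `k` is truncated. The products `(k ⊓ n) y` have images bounded by `k T y`, so maximality of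
the domain puts their supremum `k y` into `V`. -/
theorem mul_mem_and_map_mul (hmax : IsMaximalDomain V T) {k y : U} (hkV : k ∈ V) (hk : T k = k)
    (hk0 : 0 ≤ k) (hy : y ∈ V) (hy0 : 0 ≤ y) : k * y ∈ V ∧ T (k * y) = k * T y := by
  have hn0 : ∀ n : ℕ, 0 ≤ k ⊓ (n : U) := fun n => le_inf hk0 n.cast_nonneg
  have hnV : ∀ n : ℕ, (k ⊓ (n : U)) * y ∈ V := fun n =>
    hV.mul_mem_of_nonneg (hn0 n) n inf_le_right hy hy0
  have hTn : ∀ n : ℕ, T ((k ⊓ (n : U)) * y) = (k ⊓ (n : U)) * T y := fun n =>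
    hT.map_mul_of_le_natCast hV (hT.map_inf hV hkV (hV.natCast_mem n) hk (hT.map_natCast n)).2
      (hn0 n) inf_le_right hy hy0
  have hTy := hT.nonneg y hy hy0
  have hmono : Monotone fun n : ℕ => (k ⊓ (n : U)) * y :=
    (monotone_inf_natCast k).mul_const hy0
  have hlub : ∀ {z : U}, 0 ≤ z → IsLUB (Set.range fun n : ℕ => (k ⊓ (n : U)) * z) (k * z) := by
    intro z hz
    have := isLUB_mul_left hz (isLUB_inf_natCast (y := k))
    rw [← Set.range_comp] at this
    simpa only [Function.comp_def, mul_comm z] using this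
  have hmem : k * y ∈ V := by
    refine hmax _ (by rintro _ ⟨n, rfl⟩; exact hnV n) (Set.range_nonempty _)
      (directedOn_range.2 hmono.directed_le) (by rintro _ ⟨n, rfl⟩; exact mul_nonneg (hn0 n) hy0)
      ⟨k * T y, ?_⟩ _ (hlub hy0)
    rintro _ ⟨_, ⟨n, rfl⟩, rfl⟩
    simp only [hTn]
    exact mul_le_mul_of_nonneg_right inf_le_left hTy
  refine ⟨hmem, (hT.isLUB_range hnV hmono hmem (hlub hy0)).unique ?_⟩
  simp only [hTn]
  exact hlub hTy

/-- Conditional expectations are best approximations in mean square. -/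
theorem map_sub_mul_self_le {f h : U} (hf : f * f ∈ V) (hh : h * h ∈ V) (hTh : T h = h) :
    T ((f - T f) * (f - T f)) ≤ T ((f - h) * (f - h)) := by
  have hfV := hV.mem_of_mul_self_mem hf
  have hTf := hT.map_mul_self_mem hV hf
  set k := T f - h
  have hk : T k = k := by rw [map_sub, hT.idem f hfV, hTh]
  have hkk : k * k ∈ V := hV.sub_mul_self_mem hTf hh
  have hfs := hV.sub_mul_self_mem hf hTf
  -- Pythagoras: `f - T f` is orthogonal to the fixed element `k`, which removes the cross term.
  have h0 : T (k * (f - T f)) = 0 := by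
    rw [hT.map_mul_of_mul_self_mem hV hk hkk hfs, map_sub, hT.idem f hfV, sub_self, mul_zero]
  have e : (f - h) * (f - h) =
      (f - T f) * (f - T f) + (k * (f - T f) + k * (f - T f)) + k * k := by
    simp only [k]; ring
  rw [e, map_add, map_add, map_add, h0]
  have := hT.nonneg _ hkk (mul_self_nonneg_of_fRing k)
  linear_combination this

end CondOp

end FRing

/-! ### A Radon–Nikodym theorem relative to an order closed subspace. -/

section FRing

variable {U : Type*} [ConditionallyCompleteLattice U] [CommRing U] [IsOrderedRing U] [IsFRing U]

theorem mul_eq_of_le_idem {x p : U} (hx : 0 ≤ x) (hp : p * p = p) (h : x ≤ p) : x * p = x := by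
  have h1 := mul_le_mul_of_nonneg_left h (idem_nonneg (idem_compl hp))
  have h2 := mul_nonneg (idem_nonneg (idem_compl hp)) hx
  have h3 : (1 - p) * x = 0 := le_antisymm (by linear_combination h1 - hp) h2
  linear_combination -h3

theorem le_of_mul_eq_idem {x p : U} (hp' : 0 ≤ p) (hx : x * x = x)
    (h : x * p = x) : x ≤ p :=
  h ▸ idem_mul_le hx hp'

theorem idem_mul_eq_inf {p q : U} (hp : p * p = p) (hq : q * q = q) : p * q = p ⊓ q := by
  have hp0 := idem_nonneg hp
  have hq0 := idem_nonneg hq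
  refine le_antisymm (le_inf (by simpa [mul_comm] using idem_mul_le hq hp0)
    (idem_mul_le hp hq0)) ?_
  have h1 := mul_eq_of_le_idem (le_inf hp0 hq0) hp (inf_le_left : p ⊓ q ≤ p)
  rw [← h1, mul_comm]
  exact mul_le_mul_of_nonneg_left inf_le_right hp0

theorem idem_of_isLUB {D : Set U} (hD : ∀ p ∈ D, p * p = p) (hne : D.Nonempty) {u : U}
    (h : IsLUB D u) : u * u = u := by
  obtain ⟨d, hd⟩ := hne
  have hu0 : 0 ≤ u := (idem_nonneg (hD d hd)).trans (h.1 hd)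
  have hu1 : u ≤ 1 := h.2 fun p hp => idem_le_one (hD p hp)
  refine le_antisymm (by simpa using mul_le_mul_of_nonneg_right hu1 hu0) (h.2 fun p hp => ?_)
  rw [← hD p hp]
  exact mul_le_mul (h.1 hp) (h.1 hp) (idem_nonneg (hD p hp)) hu0

variable [Algebra ℝ U] [IsOrderedModule ℝ U]

/-- An order closed Riesz subspace of `V` containing the range of `T`. -/
structure IsClosedSubspace (V : Submodule ℝ U) (T : U →ₗ[ℝ] U) (F : Submodule ℝ U) : Prop where
  le : F ≤ V
  posPart_mem : ∀ x ∈ F, x⁺ ∈ F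
  closed : ∀ D : Set U, D ⊆ F → D.Nonempty → DirectedOn (· ≤ ·) D → ∀ u ∈ V, IsLUB D u → u ∈ F
  range_mem : ∀ x ∈ V, T x = x → x ∈ F

/-- `h` has the same `T`-integral as `f` over every idempotent of `F`. -/
def IsCondVersion (T : U →ₗ[ℝ] U) (F : Submodule ℝ U) (f h : U) : Prop :=
  h ∈ F ∧ ∀ p ∈ F, p * p = p → T (p * h) = T (p * f)

variable {V : Submodule ℝ U} {T : U →ₗ[ℝ] U} (hT : CondOp V T) (hV : IsUnitalIdeal V)
include hT hV

namespace CondOp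

/-- Monotone convergence: an idempotent `q` on which `D` is unbounded satisfies `n T q ≤ B` for all
`n`, hence `T q = 0` and `q = 0`. -/
theorem bddAbove_of_map_bddAbove
    (hlat : ∀ s : Set U, s.Nonempty → (∀ x ∈ s, 0 ≤ x) →
      s.Pairwise (fun x y => x ⊓ y = 0) → ∃ l, IsLUB s l)
    {D : Set U} (hDV : D ⊆ V) (hne : D.Nonempty) (hdir : DirectedOn (· ≤ ·) D)
    (hD0 : ∀ d ∈ D, 0 ≤ d) (hb : BddAbove (T '' D)) : BddAbove D := by
  obtain ⟨B, hB⟩ := hb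
  refine bddAbove_of_laterallyComplete hlat hne hD0 fun q hq hn => ?_
  have hqV := hV.idem_mem hq
  have hq0 := idem_nonneg hq
  refine hT.strict q hqV hq0 (le_antisymm (nonpos_of_nsmul_le (y := B) fun n => ?_)
    (hT.nonneg q hqV hq0))
  have hlub : IsLUB ((fun d => d ⊓ ((n : ℕ) : U)) '' D)
      (sSup ((fun d => d ⊓ ((n : ℕ) : U)) '' D)) :=
    isLUB_csSup (hne.image _) ⟨n, by rintro _ ⟨d, _, rfl⟩; exact inf_le_right⟩
  set s := sSup ((fun d => d ⊓ ((n : ℕ) : U)) '' D)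
  have hsn : s ≤ n := hlub.2 (by rintro _ ⟨d, _, rfl⟩; exact inf_le_right)
  have hs0 : 0 ≤ s := (nsmul_nonneg hq0 n).trans (hn n)
  have hsV : s ∈ V := hV.of_le _ (hV.natCast_mem n) _ hs0 hsn
  have hdV : ∀ d ∈ D, d ⊓ ((n : ℕ) : U) ∈ V := fun d hd =>
    hV.of_le d (hDV hd) _ (le_inf (hD0 d hd) n.cast_nonneg) inf_le_left
  rw [← map_nsmul]
  refine (hT.mono (V.nsmul_mem hqV n) hsV (hn n)).trans ?_
  refine (hT.cont _ (by rintro _ ⟨d, hd, rfl⟩; exact hdV d hd) (hne.image _) ?_ s hsV hlub).2 ?_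
  · rintro _ ⟨a, ha, rfl⟩ _ ⟨b, hb, rfl⟩
    obtain ⟨c, hc, hac, hbc⟩ := hdir a ha b hb
    exact ⟨_, ⟨c, hc, rfl⟩, inf_le_inf_right _ hac, inf_le_inf_right _ hbc⟩
  · rintro _ ⟨_, ⟨d, hd, rfl⟩, rfl⟩
    exact (hT.mono (hdV d hd) (hDV hd) inf_le_left).trans (hB ⟨d, hd, rfl⟩)

theorem map_mul_le_of_isLUB {D : Set U} (hne : D.Nonempty)
    (hdir : DirectedOn (· ≤ ·) D) {u : U} (hu : IsLUB D u) {f b : U} (hf : 0 ≤ f)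
    (hfD : ∀ d ∈ D, f * d ∈ V) (hfu : f * u ∈ V) (h : ∀ d ∈ D, T (f * d) ≤ b) :
    T (f * u) ≤ b := by
  refine (hT.cont _ (by rintro _ ⟨d, hd, rfl⟩; exact hfD d hd) (hne.image _) ?_ _ hfu
    (isLUB_mul_left hf hu)).2 (by rintro _ ⟨_, ⟨d, hd, rfl⟩, rfl⟩; exact h d hd)
  rintro _ ⟨a, ha, rfl⟩ _ ⟨b, hb, rfl⟩
  obtain ⟨c, hc, hac, hbc⟩ := hdir a ha b hb
  exact ⟨_, ⟨c, hc, rfl⟩, mul_le_mul_of_nonneg_left hac hf, mul_le_mul_of_nonneg_left hbc hf⟩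

end CondOp

namespace IsClosedSubspace

variable {F : Submodule ℝ U} (hF : IsClosedSubspace V T F)
include hF

theorem one_mem : (1 : U) ∈ F := hF.range_mem 1 hV.one_mem hT.map_one

theorem inf_mem {x y : U} (hx : x ∈ F) (hy : y ∈ F) : x ⊓ y ∈ F := by
  have h1 : x ⊓ y = x - (x - y)⁺ := by
    rw [posPart_def, sub_sup]; simp [inf_comm]
  rw [h1]
  exact F.sub_mem hx (hF.posPart_mem _ (F.sub_mem hx hy))

theorem idem_mul_mem {p q : U} (hp : p * p = p) (hq : q * q = q) (hpF : p ∈ F) (hqF : q ∈ F) :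
    p * q ∈ F := by
  rw [idem_mul_eq_inf hp hq]
  exact hF.inf_mem hT hV hpF hqF

theorem posIdem_mem {x : U} (hx : x ∈ F) : posIdem x ∈ F := by
  have hm : Monotone fun n : ℕ => (1 : U) ⊓ n • x⁺ := fun m n h =>
    inf_le_inf_left _ (nsmul_le_nsmul_left (posPart_nonneg x) h)
  refine hF.closed _ ?_ (Set.range_nonempty _) (directedOn_range.2 hm.directed_le) _
    (hV.idem_mem (posIdem_idem x)) (isLUB_posIdem x)
  rintro _ ⟨n, rfl⟩
  exact hF.inf_mem hT hV (hF.one_mem hT hV) (F.nsmul_mem (hF.posPart_mem x hx) n)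

/-- Testing on `posIdem h` gives `T h⁺ ≤ 0`. This makes conditional versions monotone and unique. -/
theorem nonpos_of_forall_idem {h : U} (hh : h ∈ F)
    (hle : ∀ p ∈ F, p * p = p → T (p * h) ≤ 0) : h ≤ 0 := by
  have h1 := hle _ (hF.posIdem_mem hT hV hh) (posIdem_idem h)
  rw [posIdem_mul] at h1
  have hV' := hV.posPart_mem h (hF.le hh)
  exact posPart_eq_zero.1 (hT.strict _ hV' (posPart_nonneg h)
    (le_antisymm h1 (hT.nonneg _ hV' (posPart_nonneg h))))

/-- Exhaustion: if every nonzero idempotent below `r` contains a nonzero one over which `f`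
integrates to at most `g`, then so does `r`. -/
theorem map_mul_le_of_exhaustion {f g r : U} (hf : f ∈ V) (hf0 : 0 ≤ f) (hg : g ∈ V)
    (hg0 : 0 ≤ g) (hr : r * r = r) (hrF : r ∈ F)
    (h : ∀ q ∈ F, q * q = q → q * r = q → q ≠ 0 →
      ∃ p ∈ F, p * p = p ∧ p * q = p ∧ p ≠ 0 ∧ T (p * f) ≤ T (p * g)) :
    T (r * f) ≤ T (r * g) := by
  set C : Set U := {p | p ∈ F ∧ p * p = p ∧ p ≤ r ∧ T (p * f) ≤ T (p * g)} with hC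
  obtain ⟨p0, -, hmax⟩ : ∃ m, (0 : U) ≤ m ∧ Maximal (· ∈ C) m := by
    refine zorn_le_nonempty₀ C (fun c hcC hch y hy => ?_) 0
      ⟨F.zero_mem, by simp, idem_nonneg hr, by simp⟩
    have hlub : IsLUB c (sSup c) := isLUB_csSup ⟨y, hy⟩ ⟨r, fun p hp => (hcC hp).2.2.1⟩
    have hu : sSup c * sSup c = sSup c :=
      idem_of_isLUB (fun p hp => (hcC hp).2.1) ⟨y, hy⟩ hlub
    have hdir : DirectedOn (· ≤ ·) c := hch.directedOn
    have hcV : c ⊆ V := fun p hp => hF.le (hcC hp).1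
    refine ⟨sSup c, ⟨hF.closed c (fun p hp => (hcC hp).1) ⟨y, hy⟩ hdir _ (hV.idem_mem hu) hlub,
      hu, hlub.2 fun p hp => (hcC hp).2.2.1, ?_⟩, fun z hz => hlub.1 hz⟩
    rw [mul_comm _ f]
    refine hT.map_mul_le_of_isLUB hV ⟨y, hy⟩ hdir hlub hf0 (fun d hd => ?_) ?_ fun d hd => ?_
    · rw [mul_comm]; exact hV.idem_mul_mem (hcC hd).2.1 hf
    · rw [mul_comm]; exact hV.idem_mul_mem hu hf
    · rw [mul_comm]
      refine (hcC hd).2.2.2.trans ?_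
      exact hT.mono (hV.idem_mul_mem (hcC hd).2.1 hg) (hV.idem_mul_mem hu hg)
        (mul_le_mul_of_nonneg_right (hlub.1 hd) hg0)
  obtain ⟨hp0F, hp0, hp0r, hp0T⟩ := hmax.prop
  have hp0r' := mul_eq_of_le_idem (idem_nonneg hp0) hr hp0r
  by_cases hq0 : r - p0 = 0
  · rwa [sub_eq_zero.1 hq0]
  · have hqi : (r - p0) * (r - p0) = r - p0 := by linear_combination hr + hp0 - 2 * hp0r'
    obtain ⟨p, hpF, hp, hpq, hpne, hpT⟩ := h (r - p0) (F.sub_mem hrF hp0F) hqi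
      (by linear_combination hr - hp0r') hq0
    have hpp0 : p * p0 = 0 := by
      linear_combination -p0 * hpq + p * hp0r' - p * hp0
    have hpr : p * r = p := by linear_combination hpq + hpp0
    exfalso
    apply hpne
    have hmem : p0 + p ∈ C := by
      refine ⟨F.add_mem hp0F hpF, by linear_combination hp0 + hp + 2 * hpp0, ?_, ?_⟩
      · refine le_of_mul_eq_idem (idem_nonneg hr) (by linear_combination hp0 + hp + 2 * hpp0) ?_
        linear_combination hp0r' + hpr
      · rw [add_mul, add_mul, map_add, map_add]
        exact add_le_add hp0T hpT
    have := hmax.le_of_ge hmem (le_add_of_nonneg_right (idem_nonneg hp))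
    exact le_antisymm (by simpa using this) (idem_nonneg hp)

/-- A positive set function that is nonzero dominates a positive multiple of `T` on some nonzero
idempotent. -/
theorem exists_idem_dominated {f h : U} (hf : f ∈ V) (hf0 : 0 ≤ f) (hh : h ∈ V) (hh0 : 0 ≤ h)
    (hle : ¬ T f ≤ T h) :
    ∃ (t : ℝ) (q : U), 0 < t ∧ q ∈ F ∧ q * q = q ∧ q ≠ 0 ∧
      ∀ p ∈ F, p * p = p → p * q = p → T (p * (h + t • (1 : U))) ≤ T (p * f) := by
  by_contra! hcon
  apply hle
  rw [← sub_nonpos]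
  refine le_of_forall_smul_one fun t ht => ?_
  rw [← sub_nonpos]
  have htV : h + t • (1 : U) ∈ V := V.add_mem hh (V.smul_mem _ hV.one_mem)
  have ht0 : 0 ≤ h + t • (1 : U) := add_nonneg hh0 (smul_nonneg ht.le zero_le_one)
  have hTV : ∀ x ∈ V, T x ∈ F := fun x hx => hF.range_mem _ (hT.mem x hx) (hT.idem x hx)
  have hT1F : t • (1 : U) ∈ F := F.smul_mem _ (hF.one_mem hT hV)
  -- The claim is `z ≤ 0`. On the component of `z⁺`, which `T` fixes, exhaustion turns the failure
  -- of domination into the reverse inequality of integrals, that is `z⁺ ≤ 0`.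
  set z := T f - T h - t • (1 : U) with hz
  have hzV : z ∈ V := V.sub_mem (V.sub_mem (hT.mem f hf) (hT.mem h hh))
    (V.smul_mem _ hV.one_mem)
  have hzT : T z = z := by
    rw [hz, map_sub, map_sub, hT.idem f hf, hT.idem h hh, map_smul, hT.map_one]
  have hposT : ∀ x ∈ V, T x = x → T (posIdem x) = posIdem x := fun x hxV hx => by
    have hm : Monotone fun n : ℕ => (1 : U) ⊓ n • x⁺ := fun m n h =>
      inf_le_inf_left _ (nsmul_le_nsmul_left (posPart_nonneg x) h)
    have hx' := hV.posPart_mem x hxV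
    have hn := fun n : ℕ => hT.map_inf hV hV.one_mem (V.nsmul_mem hx' n) hT.map_one
      (show T (n • x⁺) = n • x⁺ by rw [map_nsmul, hT.map_posPart hV hxV hx])
    have h1 := hT.isLUB_range (fun n => (hn n).1) hm (hV.idem_mem (posIdem_idem x))
      (isLUB_posIdem x)
    simp only [fun n => (hn n).2] at h1
    exact h1.unique (isLUB_posIdem x)
  have hr := posIdem_idem z
  have hrT := hposT z hzV hzT
  have hrz := posIdem_mul z
  set r := posIdem z
  have hrF : r ∈ F := hF.range_mem r (hV.idem_mem hr) hrT
  have key : T (r * f) ≤ T (r * (h + t • (1 : U))) := by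
    refine hF.map_mul_le_of_exhaustion hT hV hf hf0 htV ht0 hr hrF fun q hqF hq hqr hq0 => ?_
    obtain ⟨p, hpF, hp, hpq, hpT⟩ := hcon t q ht hqF hq hq0
    have hpfV := hV.idem_mul_mem hp hf
    have hphV := hV.idem_mul_mem hp htV
    -- The order is not total: failure of `≤` only says that `y⁺ ≠ 0`. Cutting `p` with the
    -- `T`-fixed component of `y⁺` yields a genuine reverse inequality on a nonzero piece.
    set y := T (p * (h + t • (1 : U))) - T (p * f) with hy
    have hyV : y ∈ V := V.sub_mem (hT.mem _ hphV) (hT.mem _ hpfV)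
    have hyT : T y = y := by rw [hy, map_sub, hT.idem _ hphV, hT.idem _ hpfV]
    have ha := posIdem_idem y
    have haT := hposT y hyV hyT
    have hay := posIdem_mul_nonneg y
    have hane : posIdem y * y ≠ 0 := fun h0 => hpT <| by
      rw [posIdem_mul, posPart_eq_zero] at h0
      exact sub_nonpos.1 h0
    set a := posIdem y
    have haF : a ∈ F := hF.range_mem a (hV.idem_mem ha) haT
    have e : ∀ x, p * x ∈ V → T (a * p * x) = a * T (p * x) := fun x hx => by
      rw [mul_assoc]; exact hT.map_idem_mul hV ha haT hx
    refine ⟨a * p, hF.idem_mul_mem hT hV ha hp haF hpF, idem_mul ha hp,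
      by linear_combination a * hpq, fun h0 => hane ?_, ?_⟩
    · rw [hy, mul_sub, ← e _ hphV, ← e _ hpfV, h0]
      simp
    · rw [e _ hphV, e _ hpfV]
      rw [hy] at hay
      linear_combination hay
  rw [hT.map_idem_mul hV hr hrT hf, hT.map_idem_mul hV hr hrT htV, map_add, map_smul,
    hT.map_one] at key
  have h1 : z⁺ ≤ 0 := by
    rw [← hrz, hz]
    linear_combination key
  exact posPart_eq_zero.1 (le_antisymm h1 (posPart_nonneg z))

/-- A Radon–Nikodym theorem: positive elements have conditional versions in `F`. -/
theorem exists_condVersion_of_nonneg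
    (hlat : ∀ s : Set U, s.Nonempty → (∀ x ∈ s, 0 ≤ x) →
      s.Pairwise (fun x y => x ⊓ y = 0) → ∃ l, IsLUB s l)
    (hmax : IsMaximalDomain V T) {f : U} (hf : f ∈ V) (hf0 : 0 ≤ f) :
    ∃ h, IsCondVersion T F f h := by
  -- Sub-densities of `f`. Chains are bounded by monotone convergence and their suprema lie in `V`
  -- by maximality of the domain, so Zorn's lemma applies.
  set H : Set U := {h | h ∈ F ∧ 0 ≤ h ∧ ∀ p ∈ F, p * p = p → T (p * h) ≤ T (p * f)}
  obtain ⟨h, -, hhmax⟩ : ∃ m, (0 : U) ≤ m ∧ Maximal (· ∈ H) m := by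
    refine zorn_le_nonempty₀ H (fun c hcH hch y hy => ?_) 0 ⟨F.zero_mem, le_rfl, fun p hpF hp => ?_⟩
    · have hdir : DirectedOn (· ≤ ·) c := hch.directedOn
      have hcV : c ⊆ V := fun x hx => hF.le (hcH hx).1
      have hTb : BddAbove (T '' c) := ⟨T f, by
        rintro _ ⟨x, hx, rfl⟩
        simpa using (hcH hx).2.2 1 (hF.one_mem hT hV) (one_mul 1)⟩
      have hb := hT.bddAbove_of_map_bddAbove hV hlat hcV ⟨y, hy⟩ hdir
        (fun x hx => (hcH hx).2.1) hTb
      have hlub : IsLUB c (sSup c) := isLUB_csSup ⟨y, hy⟩ hb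
      have huV := hmax c hcV ⟨y, hy⟩ hdir (fun x hx => (hcH hx).2.1) hTb _ hlub
      refine ⟨sSup c, ⟨hF.closed c (fun x hx => (hcH hx).1) ⟨y, hy⟩ hdir _ huV hlub,
        (hcH hy).2.1.trans (hlub.1 hy), fun p hpF hp => ?_⟩, fun x hx => hlub.1 hx⟩
      exact hT.map_mul_le_of_isLUB hV ⟨y, hy⟩ hdir hlub (idem_nonneg hp)
        (fun x hx => hV.idem_mul_mem hp (hcV hx)) (hV.idem_mul_mem hp huV)
        fun x hx => (hcH hx).2.2 p hpF hp
    · rw [mul_zero, map_zero]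
      exact hT.nonneg _ (hV.idem_mul_mem hp hf) (mul_nonneg (idem_nonneg hp) hf0)
  obtain ⟨hhF, hh0, hhT⟩ := hhmax.prop
  have hhV := hF.le hhF
  have h1 : T f ≤ T h := by
    by_contra hle
    obtain ⟨t, q, ht, hqF, hq, hq0, hdom⟩ := hF.exists_idem_dominated hT hV hf hf0 hhV hh0 hle
    apply hq0
    have htq : 0 ≤ t • q := smul_nonneg ht.le (idem_nonneg hq)
    -- Each `p` is split along `q`: domination handles `p * q`, and `h ∈ H` handles `p * (1 - q)`.
    have hmem : h + t • q ∈ H := by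
      refine ⟨F.add_mem hhF (F.smul_mem _ hqF), add_nonneg hh0 htq, fun p hpF hp => ?_⟩
      have e1 := hdom (p * q) (hF.idem_mul_mem hT hV hp hq hpF hqF) (idem_mul hp hq)
        (by linear_combination p * hq)
      have hcF := F.sub_mem (hF.one_mem hT hV) hqF
      have e2 := hhT (p * (1 - q)) (hF.idem_mul_mem hT hV hp (idem_compl hq) hpF hcF)
        (idem_mul hp (idem_compl hq))
      have s1 : p * (h + t • q) = p * q * (h + t • (1 : U)) + p * (1 - q) * h := by
        simp only [Algebra.smul_def]; ring
      have s2 : p * f = p * q * f + p * (1 - q) * f := by ring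
      rw [s1, s2, map_add, map_add]
      exact add_le_add e1 e2
    have := hhmax.le_of_ge hmem (le_add_of_nonneg_right htq)
    exact idem_eq_zero_of_smul_nonpos hq ht (by simpa using this)
  refine ⟨h, hhF, fun p hpF hp => le_antisymm (hhT p hpF hp) ?_⟩
  -- The reverse inequality on `p` is `T f ≤ T h` minus the bound on `1 - p`.
  have e1 := hhT (1 - p) (F.sub_mem (hF.one_mem hT hV) hpF) (idem_compl hp)
  rw [sub_mul, sub_mul, map_sub, map_sub, one_mul, one_mul] at e1
  linear_combination e1 + h1

theorem exists_condVersion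
    (hlat : ∀ s : Set U, s.Nonempty → (∀ x ∈ s, 0 ≤ x) →
      s.Pairwise (fun x y => x ⊓ y = 0) → ∃ l, IsLUB s l)
    (hmax : IsMaximalDomain V T) {f : U} (hf : f ∈ V) : ∃ h, IsCondVersion T F f h := by
  obtain ⟨h1, h1F, h1T⟩ := hF.exists_condVersion_of_nonneg hT hV hlat hmax
    (hV.posPart_mem f hf) (posPart_nonneg f)
  obtain ⟨h2, h2F, h2T⟩ := hF.exists_condVersion_of_nonneg hT hV hlat hmax
    (hV.negPart_mem hf) (negPart_nonneg f)
  refine ⟨h1 - h2, F.sub_mem h1F h2F, fun p hpF hp => ?_⟩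
  rw [mul_sub, map_sub, h1T p hpF hp, h2T p hpF hp, ← map_sub, ← mul_sub, posPart_sub_negPart]

theorem condVersion_mono {f f' h h' : U} (hf : f ∈ V) (hf' : f' ∈ V)
    (hh : IsCondVersion T F f h) (hh' : IsCondVersion T F f' h') (hle : f ≤ f') : h ≤ h' := by
  rw [← sub_nonpos]
  refine hF.nonpos_of_forall_idem hT hV (F.sub_mem hh.1 hh'.1) fun p hpF hp => ?_
  rw [mul_sub, map_sub, hh.2 p hpF hp, hh'.2 p hpF hp, sub_nonpos]
  exact hT.mono (hV.idem_mul_mem hp hf) (hV.idem_mul_mem hp hf')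
    (mul_le_mul_of_nonneg_left hle (idem_nonneg hp))

theorem condVersion_unique {f h h' : U} (hf : f ∈ V) (hh : IsCondVersion T F f h)
    (hh' : IsCondVersion T F f h') : h = h' :=
  le_antisymm (hF.condVersion_mono hT hV hf hf hh hh' le_rfl)
    (hF.condVersion_mono hT hV hf hf hh' hh le_rfl)

end IsClosedSubspace

end FRing

/-! ### The closed Riesz span. -/

section OneSpace

variable {E : Type*} [ConditionallyCompleteLattice E] [AddCommGroup E] [IsOrderedAddMonoid E]
  [Module ℝ E]

theorem isRieszSubspace_closedRieszSpan (A : Set E) : IsRieszSubspace (closedRieszSpan A) := by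
  intro x hx y hy
  simp only [closedRieszSpan, Submodule.mem_sInf] at *
  exact ⟨fun F hF => (hF.1 x (hx F hF) y (hy F hF)).1, fun F hF => (hF.1 x (hx F hF) y (hy F hF)).2⟩

theorem dirSupClosed_closedRieszSpan (A : Set E) :
    DirSupClosed (closedRieszSpan A : Set E) := by
  intro d hd hne hdir a ha
  simp only [closedRieszSpan, SetLike.mem_coe, Submodule.mem_sInf]
  refine fun F hF => hF.2.1 (fun x hx => ?_) hne hdir ha
  have := hd hx
  simp only [closedRieszSpan, SetLike.mem_coe, Submodule.mem_sInf] at this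
  exact this F hF

theorem subset_closedRieszSpan (A : Set E) : A ⊆ closedRieszSpan A := by
  intro x hx
  simp only [closedRieszSpan, SetLike.mem_coe, Submodule.mem_sInf]
  exact fun F hF => hF.2.2 hx

theorem closedRieszSpan_mono {A B : Set E} (h : A ⊆ B) : closedRieszSpan A ≤ closedRieszSpan B :=
  sInf_le_sInf fun _ hF => ⟨hF.1, hF.2.1, h.trans hF.2.2⟩

/-- Finite suprema make the set directed without changing its least upper bound. -/
theorem exists_isLUB_of_dirSupClosed {G : Submodule ℝ E} (hG : IsRieszSubspace G)
    (hG' : DirSupClosed (G : Set E)) (s : Set G) (hs : s.Nonempty) (hb : BddAbove s) :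
    ∃ l, IsLUB s l := by
  obtain ⟨b, hb⟩ := hb
  set s' : Set E := (fun x : G => (x : E)) '' s
  have hlub : IsLUB s' (sSup s') := isLUB_csSup (hs.image _)
    ⟨b, by rintro _ ⟨x, hx, rfl⟩; exact hb hx⟩
  have hmem : sSup s' ∈ G := by
    refine hG' (d := supClosure s') ?_ ((hs.image _).mono subset_supClosure)
      supClosed_supClosure.directedOn (isLUB_supClosure.2 hlub)
    refine supClosure_min ?_ fun x hx y hy => (hG x hx y hy).1
    rintro _ ⟨x, _, rfl⟩
    exact x.2
  refine ⟨⟨_, hmem⟩, fun x hx => hlub.1 ⟨x, hx, rfl⟩, fun c hc => hlub.2 ?_⟩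
  rintro _ ⟨x, hx, rfl⟩
  exact hc hx

end OneSpace

/-! ### Transfer to the completion and existence of conditional expectations. -/

section Completion

variable {E : Type*} [ConditionallyCompleteLattice E] [AddCommGroup E] [IsOrderedAddMonoid E]
  [Module ℝ E]
variable {U : Type*} [ConditionallyCompleteLattice U] [CommRing U] [IsOrderedRing U]
  [Algebra ℝ U]

namespace IsUniversalCompletion

variable {ι : E →ₗ[ℝ] U} {e : E} (hU : IsUniversalCompletion ι e)
include hU

theorem isFRing : IsFRing U := ⟨hU.mul_disjoint⟩

theorem le_iff {x y : E} : ι x ≤ ι y ↔ x ≤ y := by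
  rw [← sup_eq_right, ← hU.map_sup, hU.injective.eq_iff, sup_eq_right]

theorem nonneg_iff {x : E} : 0 ≤ ι x ↔ 0 ≤ x := by
  rw [← map_zero ι, hU.le_iff]

theorem map_posPart (x : E) : ι x⁺ = (ι x)⁺ := by
  rw [posPart_def, hU.map_sup, map_zero, posPart_def]

theorem map_abs (x : E) : ι |x| = |ι x| := by
  rw [abs, hU.map_sup, map_neg, abs]

theorem map_inf (x y : E) : ι (x ⊓ y) = ι x ⊓ ι y := by
  have h1 := congrArg ι (inf_add_sup x y)
  rw [map_add, map_add, hU.map_sup, ← inf_add_sup (ι x) (ι y)] at h1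
  exact add_right_cancel h1

theorem isLUB_of_image {D : Set E} {a : E} (h : IsLUB (ι '' D) (ι a)) : IsLUB D a :=
  ⟨fun d hd => hU.le_iff.1 (h.1 ⟨d, hd, rfl⟩), fun c hc => hU.le_iff.1 (h.2 (by
    rintro _ ⟨d, hd, rfl⟩
    exact hU.le_iff.2 (hc hd)))⟩

/-- Positive elements of the completion are suprema of elements of the space. -/
theorem isLUB_image_Icc {v : U} (hv : 0 ≤ v) : IsLUB (ι '' {x | 0 ≤ x ∧ ι x ≤ v}) v := by
  have hne : (ι '' {x | 0 ≤ x ∧ ι x ≤ v}).Nonempty := ⟨_, 0, ⟨le_rfl, by simpa using hv⟩, rfl⟩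
  have hub : v ∈ upperBounds (ι '' {x | 0 ≤ x ∧ ι x ≤ v}) := by
    rintro _ ⟨x, hx, rfl⟩
    exact hx.2
  have hlub := isLUB_csSup hne ⟨v, hub⟩
  set w := sSup (ι '' {x | 0 ≤ x ∧ ι x ≤ v})
  have hwv : w ≤ v := hlub.2 hub
  suffices h : w = v by rwa [h] at hlub
  by_contra hne'
  obtain ⟨y, hy0, hy⟩ := hU.orderDense (v - w)
    (sub_pos.2 (lt_of_le_of_ne hwv hne'))
  have : w ≤ w - ι y := by
    refine hlub.2 ?_
    rintro _ ⟨x, hx, rfl⟩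
    rw [le_sub_iff_add_le, ← map_add]
    refine hlub.1 ⟨x + y, ⟨add_nonneg hx.1 (hU.nonneg_iff.1 hy0.le), ?_⟩, rfl⟩
    rw [map_add]
    have h1 : ι x ≤ w := hlub.1 ⟨x, hx, rfl⟩
    linear_combination h1 + hy
  have : ι y ≤ 0 := by simpa using this
  exact absurd this hy0.not_ge

end IsUniversalCompletion

theorem mem_naturalDomain_of_pos {ι : E →ₗ[ℝ] U} {T : E →ₗ[ℝ] E} {u : U}
    (h : u ∈ naturalDomainPos ι T) : u ∈ naturalDomain ι T := by
  refine ⟨u, h, 0, ⟨le_rfl, {0}, Set.singleton_nonempty 0, directedOn_singleton _,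
    by simp, ?_, ?_⟩, by simp⟩
  · simp
  · simp

theorem mem_range_of_isLUB {ι : E →ₗ[ℝ] U} {T : E →ₗ[ℝ] E} {e : E}
    (hU : IsUniversalCompletion ι e) (hdom : IsTUniversallyComplete ι T) {D : Set E}
    (hne : D.Nonempty) (hdir : DirectedOn (· ≤ ·) D) (h0 : ∀ x ∈ D, 0 ≤ x) {u : U}
    (hu : IsLUB (ι '' D) u) (hb : BddAbove ((fun x => ι (T x)) '' D)) : u ∈ LinearMap.range ι := by
  change u ∈ Set.range ι
  rw [hdom]
  refine mem_naturalDomain_of_pos ⟨?_, D, hne, hdir, h0, hu, hb⟩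
  obtain ⟨d, hd⟩ := hne
  exact (hU.nonneg_iff.2 (h0 d hd)).trans (hu.1 ⟨d, hd, rfl⟩)

/-- If `0 ≤ v ≤ ι x`, the positive elements of `E` below `v` are directed with supremum `v`, and
their images under `T` are bounded by `T x`; so `v` is in the natural domain. -/
theorem isUnitalIdeal_range {ι : E →ₗ[ℝ] U} {T : E →ₗ[ℝ] E} {e : E}
    (hU : IsUniversalCompletion ι e) (hT : ∀ x, 0 ≤ x → 0 ≤ T x)
    (hdom : IsTUniversallyComplete ι T) : IsUnitalIdeal (LinearMap.range ι) where
  one_mem := ⟨e, hU.map_unit⟩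
  of_le := by
    rintro _ ⟨x, rfl⟩ v hv hvx
    refine mem_range_of_isLUB hU hdom ?_ ?_ (fun x hx => hx.1) (hU.isLUB_image_Icc hv) ?_
    · exact ⟨0, le_rfl, by simpa using hv⟩
    · intro a ha b hb
      exact ⟨a ⊔ b, ⟨ha.1.trans le_sup_left, by rw [hU.map_sup]; exact sup_le ha.2 hb.2⟩,
        le_sup_left, le_sup_right⟩
    · refine ⟨ι (T x), ?_⟩
      rintro _ ⟨y, hy, rfl⟩
      rw [hU.le_iff, ← sub_nonneg, ← map_sub]
      exact hT _ (sub_nonneg.2 (hU.le_iff.1 (hy.2.trans hvx)))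
  posPart_mem := by
    rintro _ ⟨x, rfl⟩
    exact ⟨x⁺, hU.map_posPart x⟩

/-- Pure linear algebra: the extension is arbitrary off the range of `ι`, which is why `CondOp`
constrains it only on `V`. -/
theorem exists_extension {ι : E →ₗ[ℝ] U} (hι : Function.Injective ι) (S : E →ₗ[ℝ] E) :
    ∃ S' : U →ₗ[ℝ] U, ∀ x, S' (ι x) = ι (S x) := by
  obtain ⟨κ, hκ⟩ := LinearMap.exists_leftInverse_of_injective ι (LinearMap.ker_eq_bot.2 hι)
  refine ⟨ι ∘ₗ S ∘ₗ κ, fun x => ?_⟩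
  have : κ (ι x) = x := LinearMap.congr_fun hκ x
  simp [this]

theorem isMaximalDomain_range {ι : E →ₗ[ℝ] U} {T : E →ₗ[ℝ] E} {e : E}
    (hU : IsUniversalCompletion ι e) (hdom : IsTUniversallyComplete ι T)
    {T' : U →ₗ[ℝ] U} (hT' : ∀ x, T' (ι x) = ι (T x)) :
    IsMaximalDomain (LinearMap.range ι) T' := by
  intro D hDV hne hdir hD0 hb u hu
  have himg : ι '' (ι ⁻¹' D) = D := Set.image_preimage_eq_of_subset hDV
  refine mem_range_of_isLUB (D := ι ⁻¹' D) hU hdom ?_ ?_ (fun x hx => hU.nonneg_iff.1 (hD0 _ hx))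
    (by rwa [himg]) ?_
  · rw [← Set.image_nonempty, himg]; exact hne
  · intro a ha b hb
    obtain ⟨c, hc, hac, hbc⟩ := hdir _ ha _ hb
    obtain ⟨c, rfl⟩ := hDV hc
    exact ⟨c, hc, hU.le_iff.1 hac, hU.le_iff.1 hbc⟩
  · rw [← himg, Set.image_image] at hb
    simpa only [hT'] using hb

variable [IsOrderedModule ℝ U]

/-- Serves both `T` and the compatible operators: strictness of `S` is inherited through `T S = T`.
-/
theorem condOp_of_isCondExp {ι : E →ₗ[ℝ] U} {T S : E →ₗ[ℝ] E} {e : E}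
    (hU : IsUniversalCompletion ι e) (hV : IsUnitalIdeal (LinearMap.range ι))
    (hTpos : IsStrictlyPositive T) (hS : IsCondExp S) (hTS : ∀ x, T (S x) = T x) (hSe : S e = e)
    {S' : U →ₗ[ℝ] U} (hS' : ∀ x, S' (ι x) = ι (S x)) : CondOp (LinearMap.range ι) S' where
  mem := by
    rintro _ ⟨x, rfl⟩
    exact ⟨S x, (hS' x).symm⟩
  nonneg := by
    rintro _ ⟨x, rfl⟩ hx
    rw [hS', hU.nonneg_iff]
    exact hS.nonneg x (hU.nonneg_iff.1 hx)
  strict := by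
    rintro _ ⟨x, rfl⟩ hx h
    rw [hS', map_eq_zero_iff ι hU.injective] at h
    by_contra h0
    have hx0 : 0 < x := lt_of_le_of_ne (hU.nonneg_iff.1 hx) (by rintro rfl; simp at h0)
    have := hTpos x hx0
    rw [← hTS, h, map_zero] at this
    exact lt_irrefl _ this
  idem := by
    rintro _ ⟨x, rfl⟩
    rw [hS', hS', hS.idem]
  map_one := by rw [← hU.map_unit, hS', hSe]
  cont := by
    rintro D hDV hne hdir _ ⟨a, rfl⟩ hu
    have := hU.isFRing
    have hmono : ∀ x y, x ≤ y → S x ≤ S y := fun x y h => by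
      have := hS.nonneg _ (sub_nonneg.2 h)
      rwa [map_sub, sub_nonneg] at this
    have himg : ι '' (ι ⁻¹' D) = D := Set.image_preimage_eq_of_subset hDV
    have hglb := hS.orderContinuous ((fun d => a - d) '' (ι ⁻¹' D)) (by
      rw [← himg, Set.image_nonempty] at hne; exact hne.image _) (by
      rintro _ ⟨x, hx, rfl⟩ _ ⟨y, hy, rfl⟩
      obtain ⟨c, hc, hac, hbc⟩ := hdir _ hx _ hy
      obtain ⟨c, rfl⟩ := hDV hc
      exact ⟨_, ⟨c, hc, rfl⟩, sub_le_sub_left (hU.le_iff.1 hac) a,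
        sub_le_sub_left (hU.le_iff.1 hbc) a⟩) (by
      constructor
      · rintro _ ⟨x, hx, rfl⟩
        exact sub_nonneg.2 (hU.le_iff.1 (hu.1 hx))
      · intro z hz
        have : ι a ≤ ι (a - z) := by
          refine hu.2 fun y hy => ?_
          obtain ⟨y, rfl⟩ := hDV hy
          rw [hU.le_iff, le_sub_comm]
          exact hz ⟨y, hy, rfl⟩
        rw [hU.le_iff] at this
        simpa using this)
    constructor
    · rintro _ ⟨y, hy, rfl⟩
      obtain ⟨x, rfl⟩ := hDV hy
      rw [hS', hS', hU.le_iff]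
      exact hmono _ _ (hU.le_iff.1 (hu.1 hy))
    · intro b hb
      obtain ⟨y, hy⟩ := hne
      obtain ⟨d, rfl⟩ := hDV hy
      have hdb : ι (S d) ≤ b := by rw [← hS']; exact hb ⟨_, hy, rfl⟩
      have hdS : S d ≤ S a := hmono _ _ (hU.le_iff.1 (hu.1 hy))
      -- The upper bound `b` need not come from `E`, but `b ⊓ ι (S a)` lies between `ι (S d)` and `ι
      -- (S a)`, hence in the ideal.
      obtain ⟨c, hc⟩ := hV.mem_of_le_of_le (y := b ⊓ ι (S a)) ⟨S d, rfl⟩ ⟨S a, rfl⟩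
        (le_inf hdb (hU.le_iff.2 hdS)) inf_le_right
      have hle : S a - c ≤ 0 := by
        refine hglb.2 ?_
        rintro _ ⟨_, ⟨x, hx, rfl⟩, rfl⟩
        rw [map_sub]
        refine sub_le_sub_left ?_ _
        rw [← hU.le_iff, hc]
        refine le_inf ?_ (hU.le_iff.2 (hmono _ _ (hU.le_iff.1 (hu.1 hx))))
        rw [← hS']
        exact hb ⟨_, hx, rfl⟩
      rw [hS']
      refine le_trans (hU.le_iff.2 (sub_nonpos.1 hle)) ?_
      rw [hc]
      exact inf_le_left

theorem isClosedSubspace_map {ι : E →ₗ[ℝ] U} {T : E →ₗ[ℝ] E} {e : E}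
    (hU : IsUniversalCompletion ι e) {T' : U →ₗ[ℝ] U} (hT' : ∀ x, T' (ι x) = ι (T x))
    {G : Submodule ℝ E} (hG : IsRieszSubspace G) (hG' : DirSupClosed (G : Set E))
    (hTG : LinearMap.range T ≤ G) : IsClosedSubspace (LinearMap.range ι) T' (G.map ι) where
  le := by
    rintro _ ⟨x, _, rfl⟩
    exact ⟨x, rfl⟩
  posPart_mem := by
    rintro _ ⟨x, hx, rfl⟩
    exact ⟨x⁺, (hG x hx 0 G.zero_mem).1, hU.map_posPart x⟩
  closed := by
    rintro D hD hne hdir _ ⟨a, rfl⟩ hu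
    have hmem : ∀ x, ι x ∈ D → x ∈ G := fun x hx => by
      obtain ⟨y, hy, hxy⟩ := hD hx
      rwa [← hU.injective hxy]
    have himg : ι '' (ι ⁻¹' D) = D := Set.image_preimage_eq_of_subset fun x hx => by
      obtain ⟨y, -, hxy⟩ := hD hx
      exact ⟨y, hxy⟩
    refine ⟨a, hG' (d := ι ⁻¹' D) hmem ?_ ?_ (hU.isLUB_of_image (by rwa [himg])), rfl⟩
    · rw [← Set.image_nonempty, himg]; exact hne
    · intro x hx y hy
      obtain ⟨c, hc, hac, hbc⟩ := hdir _ hx _ hy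
      obtain ⟨c, -, rfl⟩ := hD hc
      exact ⟨c, hc, hU.le_iff.1 hac, hU.le_iff.1 hbc⟩
  range_mem := by
    rintro _ ⟨x, rfl⟩ h
    rw [hT'] at h
    exact ⟨x, hTG ⟨x, hU.injective h⟩, rfl⟩

/-- An Andô–Douglas type theorem: every order closed Riesz subspace containing the range of `T`
is the range of a conditional expectation operator compatible with `T`. -/
theorem exists_isCondExp_range_eq {ι : E →ₗ[ℝ] U} {T : E →ₗ[ℝ] E} {e : E}
    (hU : IsUniversalCompletion ι e) (hT : IsCondExp T) (hTpos : IsStrictlyPositive T)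
    (hTe : T e = e) (hdom : IsTUniversallyComplete ι T) {G : Submodule ℝ E}
    (hG : IsRieszSubspace G) (hG' : DirSupClosed (G : Set E)) (hTG : LinearMap.range T ≤ G) :
    ∃ S : E →ₗ[ℝ] E, IsCondExp S ∧ IsCompatible T S ∧ LinearMap.range S = G := by
  have := hU.isFRing
  have hV := isUnitalIdeal_range hU hT.nonneg hdom
  obtain ⟨T', hT'⟩ := exists_extension hU.injective T
  have hC := condOp_of_isCondExp hU hV hTpos hT hT.idem hTe hT'
  have hF := isClosedSubspace_map hU hT' hG hG' hTG
  have hmax := isMaximalDomain_range hU hdom hT'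
  have hex : ∀ x : E, ∃ y : E, y ∈ G ∧ IsCondVersion T' (G.map ι) (ι x) (ι y) := fun x => by
    obtain ⟨h, hh⟩ := hF.exists_condVersion hC hV hU.laterallyComplete hmax ⟨x, rfl⟩
    obtain ⟨y, hy, rfl⟩ := hh.1
    exact ⟨y, hy, hh⟩
  choose s hsG hs using hex
  have huniq : ∀ x y, IsCondVersion T' (G.map ι) (ι x) (ι y) → s x = y := fun x y h =>
    hU.injective (hF.condVersion_unique hC hV ⟨x, rfl⟩ (hs x) h)
  set S : E →ₗ[ℝ] E :=
    { toFun := s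
      map_add' := fun x y => huniq _ _ ⟨⟨_, G.add_mem (hsG x) (hsG y), rfl⟩, fun p hpF hp => by
        rw [map_add, map_add, mul_add, mul_add, map_add, map_add, (hs x).2 p hpF hp,
          (hs y).2 p hpF hp]⟩
      map_smul' := fun c x => huniq _ _ ⟨⟨_, G.smul_mem c (hsG x), rfl⟩, fun p hpF hp => by
        rw [RingHom.id_apply, map_smul, map_smul, mul_smul_comm, mul_smul_comm, map_smul,
          map_smul, (hs x).2 p hpF hp]⟩ } with hSdef
  have hsfix : ∀ x ∈ G, s x = x := fun x hx => huniq _ _ ⟨⟨x, hx, rfl⟩, fun _ _ _ => rfl⟩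
  have hrange : LinearMap.range S = G := by
    ext x
    constructor
    · rintro ⟨y, rfl⟩
      exact hsG y
    · exact fun hx => ⟨x, hsfix x hx⟩
  have hmono : ∀ x y, x ≤ y → s x ≤ s y := fun x y h =>
    hU.le_iff.1 (hF.condVersion_mono hC hV ⟨x, rfl⟩ ⟨y, rfl⟩ (hs x) (hs y) (hU.le_iff.2 h))
  have hs0 : s 0 = 0 := map_zero S
  have hnonneg : ∀ x, 0 ≤ x → 0 ≤ s x := fun x hx => hs0 ▸ hmono 0 x hx
  have hTs : ∀ x, T (s x) = T x := fun x => by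
    have := (hs x).2 1 (hF.one_mem hC hV) (one_mul 1)
    rw [one_mul, one_mul, hT', hT'] at this
    exact hU.injective this
  have hTmono : ∀ x y, x ≤ y → T x ≤ T y := fun x y h => by
    have := hT.nonneg _ (sub_nonneg.2 h)
    rwa [map_sub, sub_nonneg] at this
  refine ⟨S, ⟨hnonneg, fun D hne hdir hD => ⟨?_, fun z hz => ?_⟩, fun x => hsfix _ (hsG x),
    hrange ▸ hG, ?_, fun u hu => ⟨hnonneg u hu.1, fun x hx => ?_⟩⟩, ⟨?_, ?_⟩, hrange⟩
  · rintro _ ⟨d, hd, rfl⟩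
    exact hnonneg d (hD.1 hd)
  -- Order continuity comes from that of `T`: the infimum `w` satisfies `T w ≤ T (S d) = T d` for
  -- all `d`, so `T w ≤ 0` and `w = 0`.
  · have hglb : IsGLB (S '' D) (sInf (S '' D)) := isGLB_csInf (hne.image _) ⟨z, hz⟩
    set w := sInf (S '' D)
    have hw0 : 0 ≤ w := hglb.2 (by
      rintro _ ⟨d, hd, rfl⟩
      exact hnonneg d (hD.1 hd))
    have hTw : T w ≤ 0 := by
      refine (hT.orderContinuous D hne hdir hD).2 ?_
      rintro _ ⟨d, hd, rfl⟩
      rw [← hTs d]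
      exact hTmono _ _ (hglb.1 ⟨d, hd, rfl⟩)
    have hw : w = 0 := by
      by_contra h0
      exact absurd hTw (hTpos w (lt_of_le_of_ne hw0 (Ne.symm h0))).not_ge
    exact hw ▸ hglb.2 hz
  · rw [hrange]
    exact exists_isLUB_of_dirSupClosed hG hG'
  -- Let `p` be the support of `S u`. Then `(1 - p) u` has the same `T`-integral as `(1 - p) S u =
  -- 0`, so it vanishes; since `u` is a weak order unit, `p = 1`.
  · have hiF : ι (s u) ∈ G.map ι := ⟨_, hsG u, rfl⟩
    have hp := posIdem_idem (ι (s u))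
    have hpF := hF.posIdem_mem hC hV hiF
    have hu0 : 0 ≤ ι (s u) := hU.nonneg_iff.2 (hnonneg u hu.1)
    have hpu := posIdem_mul (ι (s u))
    have hpd : ∀ y, 0 ≤ y → ι (s u) * y = 0 → posIdem (ι (s u)) * y = 0 := fun y hy h =>
      posIdem_mul_eq_zero hy (by rwa [posPart_of_nonneg hu0])
    rw [posPart_of_nonneg hu0] at hpu
    set p := posIdem (ι (s u))
    have hcF := (G.map ι).sub_mem (hF.one_mem hC hV) hpF
    have h1 := (hs u).2 (1 - p) hcF (idem_compl hp)
    have h2 : (1 - p) * ι (s u) = 0 := by linear_combination -hpu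
    rw [h2, map_zero] at h1
    have h3 : (1 - p) * ι u = 0 := hC.strict _ (hV.idem_mul_mem (idem_compl hp) ⟨u, rfl⟩)
      (mul_nonneg (idem_nonneg (idem_compl hp)) (hU.nonneg_iff.2 hu.1)) h1.symm
    obtain ⟨c, hcG, hc⟩ := hcF
    have hc0 : 0 ≤ ι c := hc ▸ idem_nonneg (idem_compl hp)
    have hcz : c = 0 := by
      refine hu.2 c (hU.injective ?_)
      rw [hU.map_inf, hU.map_abs, abs_of_nonneg hc0, map_zero]
      exact inf_eq_zero_of_mul_eq_zero hc0 (hU.nonneg_iff.2 hu.1) (by rw [hc]; exact h3)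
    rw [hcz, map_zero] at hc
    have h4 : ι (s u) * |ι x| = 0 := by
      rw [mul_comm]
      refine mul_eq_zero_of_inf_eq_zero ?_
      rw [← hU.map_abs, ← hU.map_inf]
      change ι (|x| ⊓ S u) = 0
      rw [hx, map_zero]
    have h5 := hpd _ (abs_nonneg _) h4
    have h6 : |ι x| = 0 := by linear_combination h5 - |ι x| * hc
    refine hU.injective (le_antisymm ?_ ?_)
    · rw [map_zero, ← h6]; exact le_abs_self _
    · rw [map_zero, ← neg_nonpos, ← h6]; exact neg_le_abs _
  · ext x
    exact hTs x
  · ext x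
    exact hsfix _ (hTG ⟨x, rfl⟩)

end Completion

/-! ### Geometric series and autoregressive estimates. -/

section FRing

variable {U : Type*} [ConditionallyCompleteLattice U] [CommRing U] [IsOrderedRing U] [IsFRing U]
  [Algebra ℝ U] [IsOrderedModule ℝ U]
variable {V : Submodule ℝ U} {T : U →ₗ[ℝ] U} (hT : CondOp V T) (hV : IsUnitalIdeal V)

/-- The geometric series with ratio `a` sums to the inverse of `1 - a`. -/
theorem isLUB_geom_sum {a w : U} (ha : 0 ≤ a) (hw : 0 ≤ w) (h : (1 - a) * w = 1) :
    IsLUB (Set.range fun n : ℕ => ∑ k ∈ Finset.range n, a ^ k) w := by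
  have hsucc : ∀ n : ℕ, ∑ k ∈ Finset.range (n + 1), a ^ k =
      1 + a * ∑ k ∈ Finset.range n, a ^ k := fun n => by
    rw [Finset.sum_range_succ', Finset.mul_sum, add_comm, pow_zero]
    simp only [pow_succ']
  have hle : ∀ n : ℕ, ∑ k ∈ Finset.range n, a ^ k ≤ w := fun n => by
    induction n with
    | zero => simpa using hw
    | succ n ih =>
      rw [hsucc]
      have := mul_le_mul_of_nonneg_left ih ha
      linear_combination this - h
  have hlub := isLUB_csSup (Set.range_nonempty fun n : ℕ => ∑ k ∈ Finset.range n, a ^ k)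
    ⟨w, by rintro _ ⟨n, rfl⟩; exact hle n⟩
  set s := sSup (Set.range fun n : ℕ => ∑ k ∈ Finset.range n, a ^ k)
  have hlub' := isLUB_mul_left ha hlub
  -- The supremum of the partial sums solves `s = 1 + a s`, so it is an inverse of `1 - a`, as is
  -- `w`.
  have h1 : s ≤ 1 + a * s := by
    refine hlub.2 ?_
    rintro _ ⟨n, rfl⟩
    have hs0 : 0 ≤ s := hlub.1 ⟨0, by simp⟩
    cases n with
    | zero => simpa using add_nonneg zero_le_one (mul_nonneg ha hs0)
    | succ n =>
      change ∑ k ∈ Finset.range (n + 1), a ^ k ≤ _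
      rw [hsucc]
      have := hlub'.1 ⟨_, ⟨n, rfl⟩, rfl⟩
      exact add_le_add_right this 1
  have h2 : a * s ≤ s - 1 := by
    refine hlub'.2 ?_
    rintro _ ⟨_, ⟨n, rfl⟩, rfl⟩
    have h3 : ∑ k ∈ Finset.range (n + 1), a ^ k ≤ s := hlub.1 ⟨n + 1, rfl⟩
    rw [hsucc] at h3
    change a * ∑ k ∈ Finset.range n, a ^ k ≤ s - 1
    linear_combination h3
  have h3 : (1 - a) * s = 1 := le_antisymm (by linear_combination h1) (by linear_combination h2)
  have h4 : s = w := by linear_combination w * h3 - s * h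
  rwa [h4] at hlub

/-- Convexity of the square, in the form adapted to autoregressive recursions. -/
theorem mul_self_step_le {θ w f x : U} (hw : 0 ≤ w) (h : (1 - |θ|) * w = 1) :
    (θ * f + x) * (θ * f + x) ≤ |θ| * (f * f) + w * (x * x) := by
  have hd := posPart_sub_negPart θ
  have hs := posPart_add_negPart θ
  have hm := posPart_mul_negPart θ
  have h1 := mul_nonneg (mul_nonneg (posPart_nonneg θ) hw)
    (mul_self_nonneg_of_fRing ((1 - |θ|) * f - x))
  have h2 := mul_nonneg (mul_nonneg (negPart_nonneg θ) hw)
    (mul_self_nonneg_of_fRing ((1 - |θ|) * f + x))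
  have haa := abs_mul_abs_of_fRing θ
  set a := |θ|
  set u := θ⁺
  set z := θ⁻
  have hz : z = a - u := by linear_combination hs
  have hθ : θ = 2 * u - a := by linear_combination -hd + hz * (-1)
  rw [hz] at h2
  -- `θ f + x` averages `± f` and `w x` with weights `|θ|` and `1 - |θ|`; the convexity defect is a
  -- sum of two squares, split by the sign of `θ`.
  have key : a * (f * f) + w * (x * x) - (θ * f + x) * (θ * f + x) =
      u * w * (((1 - a) * f - x) * ((1 - a) * f - x)) +
      (a - u) * w * (((1 - a) * f + x) * ((1 - a) * f + x)) := by
    have e1 : θ * f * x = (2 * u - a) * f * x := by rw [hθ]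
    linear_combination f * f * haa - 2 * e1 + (x * x - a * (1 - a) * (f * f) +
      (4 * u - 2 * a) * f * x) * h
  rw [← sub_nonneg, key]
  exact add_nonneg h1 h2

namespace CondOp

include hT hV

theorem pow_mem_and_map_pow {a : U} (ha0 : 0 ≤ a) (ha1 : a ≤ 1) (ha : T a = a) (n : ℕ) :
    0 ≤ a ^ n ∧ a ^ n ≤ 1 ∧ a ^ n ∈ V ∧ T (a ^ n) = a ^ n := by
  induction n with
  | zero => simpa using ⟨hV.one_mem, hT.map_one⟩
  | succ n ih =>
    obtain ⟨h0, h1, hm, h⟩ := ih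
    rw [pow_succ']
    have hle : a ≤ (1 : ℕ) := by simpa using ha1
    refine ⟨mul_nonneg ha0 h0, ?_, hV.mul_mem_of_nonneg ha0 1 hle hm h0, ?_⟩
    · simpa using mul_le_mul ha1 h1 h0 zero_le_one
    · rw [hT.map_mul_of_le_natCast hV ha ha0 hle hm h0, h]

theorem inverse_mem_and_map_inverse (hmax : IsMaximalDomain V T) {a w : U} (ha0 : 0 ≤ a)
    (ha1 : a ≤ 1) (ha : T a = a) (hw : 0 ≤ w) (h : (1 - a) * w = 1) : w ∈ V ∧ T w = w := by
  have hpow := hT.pow_mem_and_map_pow hV ha0 ha1 ha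
  have hlub := isLUB_geom_sum ha0 hw h
  set s : ℕ → U := fun n => ∑ k ∈ Finset.range n, a ^ k
  have hsV : ∀ n, s n ∈ V := fun n => V.sum_mem fun k _ => (hpow k).2.2.1
  have hsT : ∀ n, T (s n) = s n := fun n => by
    rw [map_sum]
    exact Finset.sum_congr rfl fun k _ => (hpow k).2.2.2
  have hs0 : ∀ n, 0 ≤ s n := fun n => Finset.sum_nonneg fun k _ => (hpow k).1
  have hmono : Monotone s := monotone_nat_of_le_succ fun n => by
    simp only [s, Finset.sum_range_succ]
    exact le_add_of_nonneg_right (hpow n).1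
  have hwV : w ∈ V := hmax _ (by rintro _ ⟨n, rfl⟩; exact hsV n) (Set.range_nonempty s)
    (directedOn_range.2 hmono.directed_le) (by rintro _ ⟨n, rfl⟩; exact hs0 n)
    ⟨w, by
      rintro _ ⟨_, ⟨n, rfl⟩, rfl⟩
      rw [hsT]
      exact hlub.1 ⟨n, rfl⟩⟩ _ hlub
  have := hT.isLUB_range hsV hmono hwV hlub
  simp only [hsT] at this
  exact ⟨hwV, this.unique hlub⟩

/-- The second moments of an autoregressive process with noise bounded by `b` are bounded by
`b / (1 - |θ|)`. -/
theorem autoregressive_bound (hmax : IsMaximalDomain V T) {θ w b : U} (hθT : T |θ| = |θ|)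
    (hθ1 : |θ| ≤ 1) (hw : 0 ≤ w) (h : (1 - |θ|) * w = 1) {f x : ℤ → U}
    (hf0 : ∀ n ≤ 0, f n = 0) (hstep : ∀ n, f n = θ * f (n - 1) + x n)
    (hf : ∀ n, f n * f n ∈ V) (hx : ∀ n, x n * x n ∈ V) {n : ℤ}
    (hb : ∀ k ≤ n, T (x k * x k) ≤ b * b) : T (f n * f n) ≤ (b * w) * (b * w) := by
  have ha0 : 0 ≤ |θ| := abs_nonneg θ
  have hle : |θ| ≤ (1 : ℕ) := by simpa using hθ1
  have hwV := hT.inverse_mem_and_map_inverse hV hmax ha0 hθ1 hθT hw h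
  have hzero : ∀ k ≤ 0, T (f k * f k) ≤ (b * w) * (b * w) := fun k hk => by
    rw [hf0 k hk, mul_zero, map_zero]
    exact mul_self_nonneg_of_fRing _
  have key : ∀ k : ℕ, (k : ℤ) ≤ n → T (f k * f k) ≤ (b * w) * (b * w) := fun k => by
    induction k with
    | zero => exact fun _ => hzero _ le_rfl
    | succ k ih =>
      intro hk
      have ih' := ih (by push_cast at hk; omega)
      have hxk := hb _ hk
      have hfk : f ((k + 1 : ℕ) : ℤ) = θ * f k + x ((k + 1 : ℕ) : ℤ) := by
        rw [hstep]
        congr 3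
        push_cast
        ring
      have h1 := hV.mul_mem_of_nonneg ha0 1 hle (hf k) (mul_self_nonneg_of_fRing _)
      have h2 := hT.mul_mem_and_map_mul hV hmax hwV.1 hwV.2 hw (hx ((k + 1 : ℕ) : ℤ))
        (mul_self_nonneg_of_fRing _)
      have h3 := hT.mono (hf _) (V.add_mem h1 h2.1) (hfk ▸ mul_self_step_le hw h)
      rw [map_add, h2.2, hT.map_mul_of_le_natCast hV hθT ha0 hle (hf k)
        (mul_self_nonneg_of_fRing _)] at h3
      have h4 := mul_le_mul_of_nonneg_left ih' ha0
      have h5 := mul_le_mul_of_nonneg_left hxk hw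
      -- `(b w)²` is the fixed point of the recursion: `|θ| b² w² + w b² = b² w²`, because `1 + |θ|
      -- w = w`.
      linear_combination h3 + h4 + h5 - b * b * w * h
  rcases le_or_gt n 0 with hn | hn
  · exact hzero n hn
  · have := key n.toNat (by rw [Int.toNat_of_nonneg hn.le])
    rwa [Int.toNat_of_nonneg hn.le] at this

omit hT in
theorem mul_mul_self_mem {θ y : U} (hθ1 : |θ| ≤ 1) (hy : y * y ∈ V) :
    (θ * y) * (θ * y) ∈ V := by
  have e : (θ * y) * (θ * y) = (|θ| * |θ|) * (y * y) := by
    rw [abs_mul_abs_of_fRing]; ring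
  rw [e]
  refine hV.mul_mem_of_nonneg (mul_nonneg (abs_nonneg _) (abs_nonneg _)) 1 ?_ hy
    (mul_self_nonneg_of_fRing _)
  simpa using mul_le_mul hθ1 hθ1 (abs_nonneg _) zero_le_one

/-- Fixed square integrable elements are stable under multiplication by powers of bounded fixed
elements. -/
theorem pow_mul_fixed {θ y : U} (hθT : T θ = θ) (hθ1 : |θ| ≤ 1) (hy : y * y ∈ V) (hTy : T y = y)
    (m : ℕ) : (θ ^ m * y) * (θ ^ m * y) ∈ V ∧ T (θ ^ m * y) = θ ^ m * y := by
  induction m with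
  | zero => simpa using ⟨hy, hTy⟩
  | succ m ih =>
    have e : θ ^ (m + 1) * y = θ * (θ ^ m * y) := by ring
    rw [e]
    have hθ2 : θ * θ ∈ V := by
      simpa using mul_mul_self_mem hV hθ1 (y := 1) (by simpa using hV.one_mem)
    refine ⟨mul_mul_self_mem hV hθ1 ih.1, ?_⟩
    rw [hT.map_mul_of_mul_self_mem hV hθT hθ2 ih.1, ih.2]

/-- The difference is the sum of `θ^k x (n - k)` over `k < m`, in which every term is square
integrable and fixed. -/
theorem autoregressive_remainder_fixed {θ : U} (hθT : T θ = θ) (hθ1 : |θ| ≤ 1) {f x : ℤ → U}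
    (hstep : ∀ n, f n = θ * f (n - 1) + x n) (hx : ∀ n, x n * x n ∈ V) (n : ℤ) (m : ℕ)
    (hfix : ∀ k, n - m < k → k ≤ n → T (x k) = x k) :
    (f n - θ ^ m * f (n - m)) * (f n - θ ^ m * f (n - m)) ∈ V ∧
      T (f n - θ ^ m * f (n - m)) = f n - θ ^ m * f (n - m) := by
  induction m with
  | zero => simp
  | succ m ih =>
    obtain ⟨h1, h2⟩ := ih fun k hk hkn => hfix k (by push_cast; omega) hkn
    obtain ⟨h3, h4⟩ := hT.pow_mul_fixed hV hθT hθ1 (hx (n - m))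
      (hfix (n - m) (by push_cast; omega) (by omega)) m
    have e : f n - θ ^ (m + 1) * f (n - (m + 1 : ℕ)) =
        (f n - θ ^ m * f (n - m)) + θ ^ m * x (n - m) := by
      have h5 := hstep (n - m)
      rw [show n - (m : ℤ) - 1 = n - ((m + 1 : ℕ) : ℤ) by push_cast; ring] at h5
      rw [h5]
      ring
    rw [e, map_add, h2, h4]
    exact ⟨hV.add_mul_self_mem h1 h3, rfl⟩

theorem map_pow_mul_self {θ y : U} (hθT : T |θ| = |θ|) (hθ1 : |θ| ≤ 1) (hy : y * y ∈ V)
    (m : ℕ) : T ((θ ^ m * y) * (θ ^ m * y)) = |θ| ^ m * |θ| ^ m * T (y * y) := by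
  have hpow := hT.pow_mem_and_map_pow hV (abs_nonneg θ) hθ1 hθT (m + m)
  have e : (θ ^ m * y) * (θ ^ m * y) = |θ| ^ (m + m) * (y * y) := by
    rw [← two_mul, pow_mul, pow_two |θ|, abs_mul_abs_of_fRing, mul_pow]
    ring
  rw [e, hT.map_mul_of_le_natCast hV (N := 1) hpow.2.2.2 hpow.1 (by simpa using hpow.2.1) hy
    (mul_self_nonneg_of_fRing _), pow_add]

end CondOp

/-- The mean square error of the approximation of an autoregressive process by its conditional
expectation given the last `m + 1` noise terms. -/
theorem autoregressive_error_le (hT : CondOp V T) (hV : IsUnitalIdeal V)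
    (hmax : IsMaximalDomain V T) {S : U →ₗ[ℝ] U} (hS : CondOp V S)
    (hTS : ∀ x ∈ V, T (S x) = T x) {θ w b : U} (hSθ : S θ = θ) (hθT : T |θ| = |θ|)
    (hθ1 : |θ| ≤ 1) (hw : 0 ≤ w) (h : (1 - |θ|) * w = 1) {f x : ℤ → U}
    (hf0 : ∀ n ≤ 0, f n = 0) (hstep : ∀ n, f n = θ * f (n - 1) + x n)
    (hf : ∀ n, f n * f n ∈ V) (hx : ∀ n, x n * x n ∈ V) {n : ℤ}
    (hb : ∀ k ≤ n, T (x k * x k) ≤ b * b) (m : ℕ)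
    (hfix : ∀ k, n - m ≤ k → k ≤ n → S (x k) = x k) :
    T ((f n - S (f n)) * (f n - S (f n))) ≤
      (b * (|θ| ^ (m + 1) * w)) * (b * (|θ| ^ (m + 1) * w)) := by
  -- Taking `m + 1` steps uses exactly the noise at times `n - m, …, n`, and leaves the remainder
  -- `θ^(m+1) f (n - m - 1)`; this produces the exponent `m + 1` of the rate.
  obtain ⟨h1, h2⟩ := hS.autoregressive_remainder_fixed hV hSθ hθ1 hstep hx n (m + 1)
    fun k hk hkn => hfix k (by push_cast at hk; omega) hkn
  have h3 := hS.map_sub_mul_self_le hV (hf n) h1 h2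
  have hm1 := hV.sub_mul_self_mem (hf n) (hS.map_mul_self_mem hV (hf n))
  have hm2 := hV.sub_mul_self_mem (hf n) h1
  have h4 := hT.mono (hS.mem _ hm1) (hS.mem _ hm2) h3
  rw [hTS _ hm1, hTS _ hm2, sub_sub_cancel, hT.map_pow_mul_self hV hθT hθ1 (hf _)] at h4
  have h5 := hT.autoregressive_bound hV hmax hθT hθ1 hw h hf0 hstep hf hx
    (n := n - (m + 1 : ℕ)) (b := b) fun k hk => hb k (by push_cast at hk; omega)
  have hp : 0 ≤ |θ| ^ (m + 1) := pow_nonneg (abs_nonneg θ) _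
  have h6 := mul_le_mul_of_nonneg_left h5 (mul_nonneg hp hp)
  linear_combination h4 + h6

end FRing

/-! ### Extension by zero, band projection and the conditional norm. -/

section OneSpace

variable {E : Type*} [ConditionallyCompleteLattice E] [AddCommGroup E] [IsOrderedAddMonoid E]
  [Module ℝ E]

theorem extendZ_of_nonpos (x : ℕ → E) {n : ℤ} (hn : n ≤ 0) : extendZ x n = 0 :=
  if_neg hn.not_gt

theorem le_of_bandProj_eq {a u c : E} (hu : 0 ≤ u) (h : bandProj a⁺ u = u)
    (hc : ∀ n : ℕ, u ⊓ n • a⁺ ≤ c) : u ≤ c := by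
  rw [bandProj, posPart_of_nonneg hu, negPart_eq_zero.2 hu] at h
  have h0 : (fun n : ℕ => (0 : E) ⊓ n • a⁺) = fun _ => 0 :=
    funext fun n => inf_eq_left.2 (nsmul_nonneg (posPart_nonneg a) n)
  rw [h0, Set.range_const, csSup_singleton, sub_zero] at h
  rw [← h]
  exact csSup_le (Set.range_nonempty _) (by rintro _ ⟨n, rfl⟩; exact hc n)

end OneSpace

section Completion

variable {E : Type*} [ConditionallyCompleteLattice E] [AddCommGroup E] [IsOrderedAddMonoid E]
  [Module ℝ E]
variable {U : Type*} [ConditionallyCompleteLattice U] [CommRing U] [IsOrderedRing U]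
  [Algebra ℝ U] [IsOrderedModule ℝ U] {ι : E →ₗ[ℝ] U} {e : E} {T : E →ₗ[ℝ] E}

/-- Positive square roots exist and are unique, so the set defining `norm2` is a singleton. -/
theorem norm2_spec (hU : IsUniversalCompletion ι e) (hT : ∀ x, 0 ≤ x → 0 ≤ T x) {f s : E}
    (hs : ι s = ι f * ι f) : 0 ≤ norm2 ι T f ∧ norm2 ι T f * norm2 ι T f = ι (T s) := by
  have := hU.isFRing
  have hs0 : 0 ≤ s := hU.nonneg_iff.1 (hs ▸ mul_self_nonneg_of_fRing _)
  obtain ⟨r, hr0, hr⟩ := exists_sqrt (hU.nonneg_iff.2 (hT s hs0))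
  have hset : {r : U | 0 ≤ r ∧ ∃ s : E, ι s = ι f * ι f ∧ r * r = ι (T s)} = {r} := by
    ext r'
    constructor
    · rintro ⟨h0, s', hs', hr'⟩
      have : s' = s := hU.injective (hs'.trans hs.symm)
      rw [this, ← hr] at hr'
      exact le_antisymm (le_of_mul_self_le hr0 hr'.le) (le_of_mul_self_le h0 hr'.ge)
    · rintro rfl
      exact ⟨hr0, s, hs, hr⟩
  rw [norm2, hset, csSup_singleton]
  exact ⟨hr0, hr⟩

theorem norm2_le_iff (hU : IsUniversalCompletion ι e) (hT : ∀ x, 0 ≤ x → 0 ≤ T x)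
    {T' : U →ₗ[ℝ] U} (hT' : ∀ x, T' (ι x) = ι (T x)) {f : E}
    (hf : ι f * ι f ∈ LinearMap.range ι) {b : U} (hb : 0 ≤ b) :
    norm2 ι T f ≤ b ↔ T' (ι f * ι f) ≤ b * b := by
  have := hU.isFRing
  obtain ⟨s, hs⟩ := hf
  obtain ⟨h0, h1⟩ := norm2_spec hU hT hs
  rw [← hs, hT', ← h1]
  exact ⟨fun h => mul_le_mul h h h0 hb, fun h => le_of_mul_self_le hb h⟩

end Completion

end RieszNED

/-! ### The main theorem. -/

theorem mainTheorem3 {E : Type*} [ConditionallyCompleteLattice E] [AddCommGroup E]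
    [IsOrderedAddMonoid E] [Module ℝ E] [IsOrderedModule ℝ E]
    {U : Type*} [ConditionallyCompleteLattice U] [CommRing U] [IsOrderedRing U]
    [Algebra ℝ U] [IsOrderedModule ℝ U]
    (ι : E →ₗ[ℝ] U) (e : E) (T : E →ₗ[ℝ] E)
    (he : RieszNED.IsWeakOrderUnit e)
    (hU : RieszNED.IsUniversalCompletion ι e)
    (hT : RieszNED.IsCondExp T) (hTpos : RieszNED.IsStrictlyPositive T) (hTe : T e = e)
    (hdom : RieszNED.IsTUniversallyComplete ι T)
    (θ : E) (ε f : ℕ → E) (hf : RieszNED.IsAR1 ι T θ ε f)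
    (hθ : ∀ x : E, RieszNED.bandProj ((e - |θ|)⁺) x = x)
    (g : E) (hg : 0 ≤ g) (hε : ∀ n, 1 ≤ n → RieszNED.norm2 ι T (ε n) ≤ ι g) :
    (∀ i j : ℤ, i ≤ j →
      ∃ S : E →ₗ[ℝ] E, RieszNED.IsGeneratedCondExp T (RieszNED.extendZ ε) i j S) ∧
    IsUnit (ι (e - |θ|)) ∧
    ∃ ξ : ℕ → E,
      (∀ m, ι (ξ m) = ι |θ| ^ (m + 1) * Ring.inverse (ι (e - |θ|))) ∧
      ∀ S : ℤ → ℤ → (E →ₗ[ℝ] E),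
        (∀ i j, i ≤ j → RieszNED.IsGeneratedCondExp T (RieszNED.extendZ ε) i j (S i j)) →
        (∃ d : ℤ → E, RieszNED.IsNearEpochDependentWith ι T S (RieszNED.extendZ f) d ξ) ∧
        ∀ (n : ℤ) (m : ℕ),
          RieszNED.norm2 ι T
              (RieszNED.extendZ f n - S (n - m) (n + m) (RieszNED.extendZ f n)) ≤
            ι g * ι (ξ m) := by
  open RieszNED in
  have := hU.isFRing
  have hV := isUnitalIdeal_range hU hT.nonneg hdom
  obtain ⟨T', hT'⟩ := exists_extension hU.injective T
  have hC := condOp_of_isCondExp hU hV hTpos hT hT.idem hTe hT'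
  have hmax := isMaximalDomain_range hU hdom hT'
  refine ⟨fun i j _ => ?_, ?_⟩
  · obtain ⟨S, h1, h2, h3⟩ := exists_isCondExp_range_eq hU hT hTpos hTe hdom
      (isRieszSubspace_closedRieszSpan _) (dirSupClosed_closedRieszSpan _)
      (fun x hx => subset_closedRieszSpan
        ({x | ∃ r : ℤ, i ≤ r ∧ r ≤ j ∧ x = extendZ ε r} ∪ (LinearMap.range T : Set E))
        (Or.inr hx))
    exact ⟨S, h1, h2, h3⟩
  -- `e - |θ|` is a positive weak order unit
  have hv : ι (e - |θ|) = 1 - |ι θ| := by rw [map_sub, hU.map_unit, hU.map_abs]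
  -- The band hypothesis at `e` says that `1 - |θ|` is positive everywhere; both `|θ| ≤ 1` and
  -- invertibility follow.
  have hp : posIdem (1 - |ι θ|) = 1 := by
    obtain ⟨c, hc⟩ := hV.idem_mem (posIdem_idem (1 - |ι θ|))
    refine le_antisymm (posIdem_le_one _) ?_
    rw [← hc, ← hU.map_unit, hU.le_iff]
    refine le_of_bandProj_eq he.1 (hθ e) fun n => ?_
    rw [← hU.le_iff, hc, hU.map_inf, map_nsmul, hU.map_posPart, hv, hU.map_unit]
    exact (isLUB_posIdem _).1 ⟨n, rfl⟩
  have hv0 : 0 ≤ 1 - |ι θ| := by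
    have := posIdem_mul_nonneg (1 - |ι θ|)
    rwa [hp, one_mul] at this
  have hθ1 : |ι θ| ≤ 1 := sub_nonneg.1 hv0
  obtain ⟨w, hw0, hw⟩ := exists_inverse hU.laterallyComplete hv0 fun q hq hqv => by
    have := mul_posIdem_eq_zero hq hqv.le
    rwa [hp, mul_one] at this
  have hinv : Ring.inverse (ι (e - |θ|)) = w := by
    rw [hv]
    exact Ring.inverse_unit (Units.mkOfMulEqOne _ w hw)
  refine ⟨hv ▸ IsUnit.of_mul_eq_one w hw, ?_⟩
  -- the rate
  have hTθ : T' (ι θ) = ι θ := by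
    obtain ⟨y, hy⟩ := hf.coeff_mem
    rw [hT', ← hy, hT.idem]
  have hθV : ι θ ∈ LinearMap.range ι := ⟨θ, rfl⟩
  have hTa : T' |ι θ| = |ι θ| := by
    have h1 := hC.map_posPart hV hθV hTθ
    rw [← posPart_add_negPart, map_add, h1]
    have h2 : (ι θ)⁻ = (ι θ)⁺ - ι θ := by
      nth_rw 3 [← posPart_sub_negPart (ι θ)]
      abel
    rw [h2, map_sub, h1, hTθ]
  have hwV := hC.inverse_mem_and_map_inverse hV hmax (abs_nonneg _) hθ1 hTa hw0 hw
  have hpow := hC.pow_mem_and_map_pow hV (abs_nonneg _) hθ1 hTa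
  have hξex : ∀ m : ℕ, ∃ x : E, ι x = |ι θ| ^ (m + 1) * w ∧ T x = x := fun m => by
    obtain ⟨⟨x, hx⟩, h2⟩ := hC.mul_mem_and_map_mul hV hmax hwV.1 hwV.2 hw0 (hpow (m + 1)).2.2.1
      (hpow (m + 1)).1
    refine ⟨x, by rw [hx, mul_comm], hU.injective ?_⟩
    rw [← hT', hx, h2, (hpow (m + 1)).2.2.2]
  choose ξ hξ hTξ using hξex
  have hξ0 : ∀ m, 0 ≤ ξ m := fun m => by
    rw [← hU.nonneg_iff, hξ]
    exact mul_nonneg (hpow _).1 hw0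
  refine ⟨ξ, fun m => by rw [hξ, hinv, hU.map_abs], fun S hS => ?_⟩
  -- the extended processes
  have hf0 : ∀ n ≤ 0, ι (extendZ f n) = 0 := fun n hn => by rw [extendZ_of_nonpos f hn, map_zero]
  have hf2 : ∀ n, ι (extendZ f n) * ι (extendZ f n) ∈ LinearMap.range ι := fun n => by
    rcases le_or_gt n 0 with hn | hn
    · rw [hf0 n hn, mul_zero]; exact zero_mem _
    · rw [extendZ, if_pos hn]; exact hf.mem _ (by omega)
  have hx2 : ∀ n, ι (extendZ ε n) * ι (extendZ ε n) ∈ LinearMap.range ι := fun n => by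
    rcases le_or_gt n 0 with hn | hn
    · rw [extendZ_of_nonpos ε hn, map_zero, mul_zero]; exact zero_mem _
    · rw [extendZ, if_pos hn]; exact hf.noise_mem _ (by omega)
  have hstep : ∀ n, ι (extendZ f n) = ι θ * ι (extendZ f (n - 1)) + ι (extendZ ε n) := fun n => by
    rcases le_or_gt n 0 with hn | hn
    · rw [hf0 n hn, hf0 (n - 1) (by omega), extendZ_of_nonpos ε hn, map_zero, mul_zero, zero_add]
    · obtain ⟨k, rfl⟩ : ∃ k : ℕ, n = (k : ℤ) + 1 := ⟨(n - 1).toNat, by omega⟩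
      have h1 : extendZ f ((k : ℤ) + 1 - 1) = f k := by
        rw [add_sub_cancel_right]
        rcases k.eq_zero_or_pos with rfl | hk
        · rw [extendZ_of_nonpos f (by simp), hf.init]
        · rw [extendZ, if_pos (by exact_mod_cast hk), Int.toNat_natCast]
      rw [h1, extendZ, if_pos hn, extendZ, if_pos hn]
      exact hf.step k
  -- the operators
  have hSC : ∀ i j, i ≤ j → (∀ x, T (S i j x) = T x) ∧ (∀ x, S i j (T x) = T x) := fun i j hij =>
    ⟨LinearMap.congr_fun (hS i j hij).compatible.1, LinearMap.congr_fun (hS i j hij).compatible.2⟩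
  -- The bound `b` is left free: `ι (d n)` gives near-epoch dependence and `ι g` the explicit
  -- estimate. Only noise up to time `n` has to be bounded.
  have main : ∀ (n : ℤ) (m : ℕ) (b : U), 0 ≤ b →
      (∀ k ≤ n, T' (ι (extendZ ε k) * ι (extendZ ε k)) ≤ b * b) →
      norm2 ι T (extendZ f n - S (n - m) (n + m) (extendZ f n)) ≤ b * ι (ξ m) := by
    intro n m b hb0 hb
    have hij : n - (m : ℤ) ≤ n + m := by omega
    obtain ⟨hTS, hST⟩ := hSC _ _ hij
    have hG := hS _ _ hij
    set R := S (n - m) (n + m)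
    obtain ⟨R', hR'⟩ := exists_extension hU.injective R
    have hRC := condOp_of_isCondExp hU hV hTpos hG.condExp hTS
      (by rw [← hTe]; exact hST e) hR'
    have hfix : ∀ k, n - m ≤ k → k ≤ n → R' (ι (extendZ ε k)) = ι (extendZ ε k) := by
      intro k hk hkn
      have h1 : extendZ ε k ∈ LinearMap.range R := by
        rw [hG.range_eq]
        exact subset_closedRieszSpan _ (Or.inl ⟨k, hk, by omega, rfl⟩)
      obtain ⟨y, hy⟩ := h1
      rw [hR', ← hy, hG.condExp.idem]
    have hRθ : R' (ι θ) = ι θ := by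
      obtain ⟨y, hy⟩ := hf.coeff_mem
      rw [hR', ← hy, hST]
    have hmem : ι (extendZ f n - R (extendZ f n)) * ι (extendZ f n - R (extendZ f n)) ∈
        LinearMap.range ι := by
      rw [map_sub, ← hR']
      exact hV.sub_mul_self_mem (hf2 n) (hRC.map_mul_self_mem hV (hf2 n))
    have hξm : 0 ≤ ι (ξ m) := hU.nonneg_iff.2 (hξ0 m)
    rw [norm2_le_iff hU hT.nonneg hT' hmem (mul_nonneg hb0 hξm), map_sub, ← hR', hξ]
    exact autoregressive_error_le hC hV hmax hRC
      (by rintro _ ⟨x, rfl⟩; rw [hR', hT', hT', hTS]) hRθ hTa hθ1 hw0 hw hf0 hstep hf2 hx2 hb m hfix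
  refine ⟨?_, fun n m => main n m (ι g) (hU.nonneg_iff.2 hg) fun k _ => ?_⟩
  -- Membership of `g` in `L²(T)` is not assumed, so `d n` is built from the noise: its square is
  -- the sum of `T (ε_k²)` over `0 ≤ k ≤ n`, a finite sum in `E`.
  · have hdex : ∀ n : ℤ, ∃ d : E, 0 ≤ d ∧ MemL2 ι d ∧
        ∀ k ≤ n, T' (ι (extendZ ε k) * ι (extendZ ε k)) ≤ ι d * ι d := by
      intro n
      have hk0 : ∀ k, 0 ≤ T' (ι (extendZ ε k) * ι (extendZ ε k)) := fun k =>
        hC.nonneg _ (hx2 k) (mul_self_nonneg_of_fRing _)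
      obtain ⟨b, hb0, hb⟩ := exists_sqrt (Finset.sum_nonneg
        fun k (_ : k ∈ Finset.Icc 0 n) => hk0 k)
      have hbV : b * b ∈ LinearMap.range ι := by
        rw [hb]
        exact Submodule.sum_mem _ fun k _ => hC.mem _ (hx2 k)
      obtain ⟨d, rfl⟩ := hV.mem_of_mul_self_mem hbV
      refine ⟨d, hU.nonneg_iff.1 hb0, hbV, fun k hk => ?_⟩
      rcases lt_or_ge k 0 with hk' | hk'
      · rw [extendZ_of_nonpos ε hk'.le, map_zero, mul_zero, map_zero]
        exact mul_self_nonneg_of_fRing _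
      · rw [hb]
        exact Finset.single_le_sum (fun k _ => hk0 k) (Finset.mem_Icc.2 ⟨hk', hk⟩)
    choose d hd0 hd2 hd using hdex
    refine ⟨d, fun i j hij => ⟨(hS i j hij).condExp, (hS i j hij).compatible⟩,
      fun i j hij => ⟨?_, ?_⟩, fun n => hf2 n, fun n => ⟨hd0 n, hd2 n⟩,
      fun m => ⟨hξ0 m, ξ m, hTξ m⟩, ⟨ξ, ?_, ?_, ?_⟩,
      fun n m => main n m _ (hU.nonneg_iff.2 (hd0 n)) (hd n)⟩
    · rw [(hS _ _ (by omega : i + 1 ≤ j)).range_eq, (hS _ _ hij.le).range_eq]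
      exact closedRieszSpan_mono (Set.union_subset_union_left _ fun x ⟨r, h1, h2, h3⟩ =>
        ⟨r, by omega, h2, h3⟩)
    · rw [(hS _ _ (by omega : i ≤ j + 1)).range_eq, (hS _ _ hij.le).range_eq]
      exact closedRieszSpan_mono (Set.union_subset_union_left _ fun x ⟨r, h1, h2, h3⟩ =>
        ⟨r, h1, by omega, h3⟩)
    · refine antitone_nat_of_succ_le fun m => ?_
      rw [← hU.le_iff, hξ, hξ, pow_succ' _ (m + 1)]
      refine mul_le_mul_of_nonneg_right ?_ hw0
      simpa using mul_le_mul_of_nonneg_right hθ1 (hpow (m + 1)).1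
    · refine ⟨by rintro _ ⟨m, rfl⟩; exact hξ0 m, fun z hz => ?_⟩
      -- `ξ n` is `w` minus the partial sum through `|θ|^n`. A common lower bound `z` therefore
      -- keeps all partial sums below `w - z`, while their supremum is `w`.
      have hle : w ≤ w - ι z := by
        refine (isLUB_geom_sum (abs_nonneg _) hw0 hw).2 ?_
        rintro _ ⟨n, rfl⟩
        have h1 : ι z ≤ ι (ξ n) := hU.le_iff.2 (hz ⟨n, rfl⟩)
        have h2 := (hpow n).1
        have h3 := geom_sum_mul_neg |ι θ| (n + 1)
        rw [Finset.sum_range_succ] at h3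
        rw [hξ] at h1
        change ∑ k ∈ Finset.range n, |ι θ| ^ k ≤ w - ι z
        linear_combination h1 + h2 + w * h3 - (∑ k ∈ Finset.range n, |ι θ| ^ k + |ι θ| ^ n) * hw
      have : ι z ≤ ι 0 := by simpa using hle
      exact hU.le_iff.1 this
    · intro m
      rw [sub_zero, abs_of_nonneg (hξ0 m)]
  · rcases le_or_gt k 0 with hk | hk
    · rw [extendZ_of_nonpos ε hk, map_zero, mul_zero, map_zero]
      exact mul_self_nonneg_of_fRing _
    · rw [extendZ, if_pos hk]
      exact (norm2_le_iff hU hT.nonneg hT' (hf.noise_mem _ (by omega))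
        (hU.nonneg_iff.2 hg)).1 (hε _ (by omega))
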